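/- Let $S_\infty=\bigcup_n S_n$ be the group of permutations of $\{1,2,3,\dots\}$ that fix all but finitely many letters, and for $w\in S_\infty$ let $\ell(w)$ be its number of inversions. The Schubert polynomial of $w$ is $$\mathfrak S_w=\sum_{a}\ \sum_{(i_1,\dots,i_p)}x_{i_1}\cdots x_{i_p}\in\mathbb Z[x_1,x_2,\dots],\qquad p=\ell(w),$$ where $a=(a_1,\dots,a_p)$ runs over the reduced words of $w$ ($w=s_{a_1}\cdots s_{a_p}$ with $s_b$ the transposition of $b$ and $b+1$) and $(i_1,\dots,i_p)$ over the sequences of positive integers with $i_1\le\cdots\le i_p$, $i_t\le a_t$ for all $t$, and $i_t<i_{t+1}$ whenever $a_t<a_{t+1}$. For $k\ge 0$ let $1^k\times w\in S_\infty$ be the permutation that fixes $1,\dots,k$ and sends $k+p$ to $k+w(p)$ for $p\ge1$ (so $1\times w=1^1\times w$), and let $e_i^k=\sum_{1\le r_1<\cdots<r_i\le k}x_{r_1}\cdots x_{r_i}$. Lemma. Let $0\le i\le j$ be integers and let $w\in S_\infty$. For every $k\ge 0$ there is a unique expansion $$e_i^{\,j+k}\,\mathfrak S_{1^k\times w}=\sum_{v\in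 S_\infty}\beta^{(k)}_v\,\mathfrak S_v$$ with integer coefficients, only finitely many of them nonzero. Put $W_0=\{v:\beta^{(0)}_v\ne0\}$ and, for $k\ge1$, let $$W_k=\{v:\beta^{(k)}_v\neq 0\}\setminus\{1\times u:\beta^{(k-1)}_u\ne0\}$$ be the set of new permutations in the $k$-th expansion compared to the $(k-1)$-st. These expansions have the strong stable property: 1. For all $k\ge0$ and $v\in S_\infty$ we have $\beta^{(k+1)}_{1\times v}=\beta^{(k)}_v$, and $v(1)\ne1$ for all $v\in W_k$ with $k\ge1$. 2. There exists an integer $r\ge0$ such that $W_s\ne\emptyset$ for $1\le s\le r$, $W_s=\emptyset$ for all $s>r$, and for all $k\ge r$ $$e_i^{\,j+k}\,\mathfrak S_{1^k\times w}=\sum_{s=0}^{r}\ \sum_{v\in W_s}\beta^{(s)}_v\,\mathfrak S_{1^{k-s}\times v}.$$ -/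

import Mathlib

/-- The infinite symmetric group `S_∞ = ⋃ₙ Sₙ`: the permutations of `ℕ` that fix all but finitely
many numbers. Positions and values are counted from `0`, so the letter `p` of `{1, 2, 3, …}` is
represented by `p - 1`. -/
def SInf : Type :=
  {w : Equiv.Perm ℕ // ∃ N, ∀ p, N ≤ p → w p = p}

namespace SInf

/-- The length of a permutation: its number of inversions. -/
noncomputable def length (w : SInf) : ℕ :=
  Set.ncard {pq : ℕ × ℕ | pq.1 < pq.2 ∧ w.1 pq.2 < w.1 pq.1}

/-- The set `R(w)` of reduced words `a₁ ⋯ a_p` of `w`, i.e. `w = s_{a₁} ⋯ s_{a_p}` with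
`p = ℓ(w)`, where `s_a` is the transposition of `a` and `a + 1`. -/
def reducedWords (w : SInf) : Set (List ℕ) :=
  {a | (a.map fun b => Equiv.swap b (b + 1)).prod = w.1 ∧ a.length = w.length}

/-- The set `K(a)` of `a`-compatible sequences. -/
def compatible (a : List ℕ) : Set (List ℕ) :=
  {b | b.length = a.length ∧
    (∀ t, t + 1 < a.length → b.getD t 0 ≤ b.getD (t + 1) 0) ∧
    (∀ t, t < a.length → b.getD t 0 ≤ a.getD t 0) ∧
    (∀ t, t + 1 < a.length → a.getD t 0 < a.getD (t + 1) 0 →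
      b.getD t 0 < b.getD (t + 1) 0)}

/-- The Schubert polynomial
`𝔖_w = ∑_{a ∈ R(w)} ∑_{(i₁, …, i_p) ∈ K(a)} x_{i₁} ⋯ x_{i_p}` (both sums are finite). -/
noncomputable def schubert (w : SInf) : MvPolynomial ℕ ℤ :=
  ∑ᶠ (a : List ℕ) (_ : a ∈ w.reducedWords), ∑ᶠ (b : List ℕ) (_ : b ∈ compatible a),
    (b.map MvPolynomial.X).prod

/-- The permutation `1ᵏ × w`: it fixes the first `k` letters and acts as `w`, shifted by `k`, on
the remaining ones. -/
def onePow (k : ℕ) (w : SInf) : SInf :=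
  ⟨{ toFun := fun p => if p < k then p else w.1 (p - k) + k
     invFun := fun p => if p < k then p else w.1.symm (p - k) + k
     left_inv := by
       intro p
       by_cases h : p < k
       · simp [h]
       · simp [h]; omega
     right_inv := by
       intro p
       by_cases h : p < k
       · simp [h]
       · simp [h]; omega },
   by
     obtain ⟨N, hN⟩ := w.2
     refine ⟨N + k, fun p hp => ?_⟩
     have h1 : ¬ p < k := by omega
     have h2 := hN (p - k) (by omega)
     simp only [Equiv.coe_fn_mk, h1, if_false, h2]
     omega⟩

end SInf

/-- The elementary symmetric polynomial `e_i^k` of degree `i` in the first `k` variables. -/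
noncomputable def elemSym (i k : ℕ) : MvPolynomial ℕ ℤ :=
  ∑ t ∈ (Finset.range k).powersetCard i, ∏ p ∈ t, MvPolynomial.X p

/-- `c` is the family of coefficients of an expansion of `f` into Schubert polynomials. -/
def IsSchubertExpansion (f : MvPolynomial ℕ ℤ) (c : SInf →₀ ℤ) : Prop :=
  f = ∑ v ∈ c.support, MvPolynomial.C (c v) * v.schubert

open Classical in
/-- Given the coefficients `c k` of the `k`-th expansion, `newPerms c 0` is the set of permutations
in the `0`-th expansion, and `newPerms c k` for `k ≥ 1` is the set of new permutations in the
`k`-th expansion compared to the `(k - 1)`-st, i.e. those not of the form `1 × u` with `u` in the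
`(k - 1)`-st expansion. -/
noncomputable def newPerms (c : ℕ → SInf →₀ ℤ) : ℕ → Finset SInf
  | 0 => (c 0).support
  | k + 1 => (c (k + 1)).support \ (c k).support.image (SInf.onePow 1)

/-!
The nil-Coxeter relations and the Yang–Baxter equation compute the divided differences
`∂_a 𝔖_w`, equal to `𝔖_{w s_a}` or to `0`. A polynomial is constant if all its divided differences
vanish; by induction on descents, expansions into Schubert polynomials are thus unique, Monk's rule
holds, and every polynomial has an expansion. In the same way the substitution `x₀ = 0`,
`x_{k+1} = x_k` sends `𝔖_{1 × u}` to `𝔖_u` and every other `𝔖_v` to `0`. As it also sends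
`e_i^{m+1}` to `e_i^m`, the coefficients are stable and new permutations move the first letter.

Monk's rule rearranges into a Pieri rule in which `∏_{k < m} (1 + x_k)` acts as a product of
operators with nonnegative coefficients, one for each value, the value `0` acting last. A
permutation that is new for `e_{i+1}` at step `k + 1` therefore covers one that is new for `e_i` at
step `k`, so nothing is new after step `i`. Finally, the derivation `∇ = ∑ₖ ∂/∂xₖ` has nonnegative
coefficients on Schubert polynomials and maps `e_{i+1}^m` to `(m - i) e_i^m`, so something is new
for `e_{i+1}` at each step where something is new for `e_i`. Hence there are no gaps.
-/

namespace SInf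

instance : One SInf := ⟨⟨1, 0, fun _ _ => rfl⟩⟩

theorem one_apply (p : ℕ) : (1 : SInf).1 p = p := rfl

theorem ext_apply {v w : SInf} (h : ∀ p, v.1 p = w.1 p) : v = w :=
  Subtype.ext (Equiv.ext h)

theorem apply_ne_apply (w : SInf) {p q : ℕ} (h : p ≠ q) : w.1 p ≠ w.1 q :=
  w.1.injective.ne h

theorem ascent_or_descent (w : SInf) (a : ℕ) : w.1 a < w.1 (a + 1) ∨ w.1 (a + 1) < w.1 a :=
  lt_or_gt_of_ne (w.apply_ne_apply a.succ_ne_self.symm)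

/-- The permutation `w` belongs to the finite symmetric group on the letters `0, …, N - 1`. -/
def FixesFrom (w : SInf) (N : ℕ) : Prop := ∀ p, N ≤ p → w.1 p = p

theorem exists_fixesFrom (w : SInf) : ∃ N, w.FixesFrom N := w.2

theorem exists_fixesFrom_ge (w : SInf) (M : ℕ) : ∃ N, M ≤ N ∧ w.FixesFrom N := by
  obtain ⟨N, hN⟩ := w.exists_fixesFrom
  exact ⟨max M N, le_max_left M N, fun p hp => hN p (le_of_max_le_right hp)⟩

theorem FixesFrom.mono {N N' : ℕ} {w : SInf} (h : w.FixesFrom N) (hN : N ≤ N') :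
    w.FixesFrom N' :=
  fun p hp => h p (hN.trans hp)

theorem FixesFrom.apply_lt {N : ℕ} {w : SInf} (h : w.FixesFrom N) {p : ℕ} (hp : p < N) :
    w.1 p < N := by
  by_contra! hN
  have hfix : w.1 p = p := w.1.injective (h _ hN)
  omega

theorem FixesFrom.lt_of_inversion {N : ℕ} {w : SInf} (h : w.FixesFrom N) {p q : ℕ} (hpq : p < q)
    (hw : w.1 q < w.1 p) : q < N := by
  by_contra! hq
  rw [h q hq] at hw
  rcases lt_or_ge p N with hp | hp
  · have := h.apply_lt hp
    omega
  · rw [h p hp] at hw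
    omega

/-- The product of `w` with the transposition of `a` and `b` on the right, which exchanges the
values of `w` at the positions `a` and `b`. -/
def mulSwap (w : SInf) (a b : ℕ) : SInf :=
  ⟨w.1 * Equiv.swap a b, by
    obtain ⟨N, hN⟩ := w.exists_fixesFrom
    refine ⟨max N (max (a + 1) (b + 1)), fun p hp => ?_⟩
    rw [Equiv.Perm.mul_apply, Equiv.swap_apply_of_ne_of_ne (by omega) (by omega)]
    exact hN p (by omega)⟩

theorem mulSwap_apply (w : SInf) (a b p : ℕ) :
    (w.mulSwap a b).1 p = w.1 (Equiv.swap a b p) := rfl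

theorem mulSwap_apply_left (w : SInf) (a b : ℕ) : (w.mulSwap a b).1 a = w.1 b := by
  rw [mulSwap_apply, Equiv.swap_apply_left]

theorem mulSwap_apply_right (w : SInf) (a b : ℕ) : (w.mulSwap a b).1 b = w.1 a := by
  rw [mulSwap_apply, Equiv.swap_apply_right]

theorem mulSwap_apply_of_ne (w : SInf) {a b p : ℕ} (ha : p ≠ a) (hb : p ≠ b) :
    (w.mulSwap a b).1 p = w.1 p := by
  rw [mulSwap_apply, Equiv.swap_apply_of_ne_of_ne ha hb]

theorem mulSwap_apply_ite (w : SInf) (a b p : ℕ) :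
    (w.mulSwap a b).1 p = if p = a then w.1 b else if p = b then w.1 a else w.1 p := by
  rw [mulSwap_apply, Equiv.swap_apply_def]
  split_ifs <;> rfl

theorem mulSwap_mulSwap_self (w : SInf) (a b : ℕ) : (w.mulSwap a b).mulSwap a b = w :=
  ext_apply fun p => by simp only [mulSwap_apply, Equiv.swap_apply_self]

theorem mulSwap_comm (w : SInf) {a b c d : ℕ} (hac : a ≠ c) (had : a ≠ d) (hbc : b ≠ c)
    (hbd : b ≠ d) : (w.mulSwap a b).mulSwap c d = (w.mulSwap c d).mulSwap a b := by
  refine ext_apply fun p => ?_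
  simp only [mulSwap_apply_ite]
  grind

theorem mulSwap_mulSwap (w : SInf) (a b p q : ℕ) :
    (w.mulSwap p q).mulSwap a b =
      (w.mulSwap a b).mulSwap (Equiv.swap a b p) (Equiv.swap a b q) := by
  refine Subtype.ext ?_
  change w.1 * Equiv.swap p q * Equiv.swap a b = w.1 * Equiv.swap a b * Equiv.swap _ _
  rw [Equiv.swap_apply_apply, Equiv.swap_inv]
  simp only [mul_assoc, Equiv.swap_mul_self_mul]

theorem FixesFrom.mulSwap {N : ℕ} {w : SInf} (h : w.FixesFrom N) {a b : ℕ} (ha : a < N)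
    (hb : b < N) : (w.mulSwap a b).FixesFrom N := fun p hp => by
  rw [mulSwap_apply_of_ne _ (by omega) (by omega), h p hp]

/-- The inversions of `w`, whose number is the length of `w`. -/
def inversions (w : SInf) : Set (ℕ × ℕ) := {pq | pq.1 < pq.2 ∧ w.1 pq.2 < w.1 pq.1}

theorem finite_inversions (w : SInf) : w.inversions.Finite := by
  obtain ⟨N, hN⟩ := w.exists_fixesFrom
  refine ((Set.finite_Iio N).prod (Set.finite_Iio N)).subset fun pq hpq => ?_
  have hq := hN.lt_of_inversion hpq.1 hpq.2
  exact ⟨hpq.1.trans hq, hq⟩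

theorem length_one : (1 : SInf).length = 0 := by
  have hempty : (1 : SInf).inversions = ∅ :=
    Set.eq_empty_of_forall_notMem fun _ h => h.1.asymm h.2
  rw [length, ← inversions, hempty, Set.ncard_empty]

theorem swap_adjacent_lt_swap_adjacent {a p q : ℕ} (hpq : p < q) (hne : ¬(p = a ∧ q = a + 1)) :
    Equiv.swap a (a + 1) p < Equiv.swap a (a + 1) q := by
  simp only [Equiv.swap_apply_def]
  split_ifs <;> omega

theorem inversions_mulSwap_of_ascent (w : SInf) {a : ℕ} (h : w.1 a < w.1 (a + 1)) :
    (w.mulSwap a (a + 1)).inversions = insert (a, a + 1)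
      (Prod.map (Equiv.swap a (a + 1)) (Equiv.swap a (a + 1)) '' w.inversions) := by
  ext ⟨p, q⟩
  constructor
  · intro hpq
    by_cases hne : p = a ∧ q = a + 1
    · exact Or.inl (Prod.ext hne.1 hne.2)
    · exact Or.inr ⟨(Equiv.swap a (a + 1) p, Equiv.swap a (a + 1) q),
        ⟨swap_adjacent_lt_swap_adjacent hpq.1 hne, hpq.2⟩, by simp⟩
  · rintro (hpq | ⟨⟨p', q'⟩, hpq, rfl, rfl⟩)
    · obtain ⟨rfl, rfl⟩ := Prod.mk.inj hpq
      refine ⟨Nat.lt_succ_self _, ?_⟩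
      rwa [mulSwap_apply_left, mulSwap_apply_right]
    · refine ⟨swap_adjacent_lt_swap_adjacent hpq.1 ?_, ?_⟩
      · rintro ⟨rfl, rfl⟩
        exact hpq.2.asymm h
      · simpa only [mulSwap_apply, Equiv.swap_apply_self] using hpq.2

theorem length_mulSwap_of_ascent (w : SInf) {a : ℕ} (h : w.1 a < w.1 (a + 1)) :
    (w.mulSwap a (a + 1)).length = w.length + 1 := by
  have hnew : (a, a + 1) ∉
      Prod.map (Equiv.swap a (a + 1)) (Equiv.swap a (a + 1)) '' w.inversions := by
    rintro ⟨⟨p, q⟩, hpq, heq⟩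
    obtain ⟨hp, hq⟩ := Prod.ext_iff.1 heq
    have hp' : p = a + 1 := by simpa using (Equiv.swap_apply_eq_iff.1 hp)
    have hq' : q = a := by simpa using (Equiv.swap_apply_eq_iff.1 hq)
    have := hpq.1
    omega
  rw [length, ← inversions, w.inversions_mulSwap_of_ascent h,
    Set.ncard_insert_of_notMem hnew (w.finite_inversions.image _),
    Set.ncard_image_of_injective _ (Prod.map_injective.2 ⟨Equiv.injective _, Equiv.injective _⟩),
    length, inversions]

theorem length_mulSwap_of_descent (w : SInf) {a : ℕ} (h : w.1 (a + 1) < w.1 a) :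
    (w.mulSwap a (a + 1)).length + 1 = w.length := by
  have hasc := (w.mulSwap a (a + 1)).length_mulSwap_of_ascent (a := a)
    (by rwa [mulSwap_apply_left, mulSwap_apply_right])
  rw [← hasc, mulSwap_mulSwap_self]

theorem exists_descent {w : SInf} (hw : w ≠ 1) : ∃ a, w.1 (a + 1) < w.1 a := by
  by_contra! h
  have hmono : StrictMono w.1 := strictMono_nat_of_lt_succ fun a =>
    (h a).lt_of_ne (w.apply_ne_apply a.succ_ne_self.symm)
  let e : ℕ ≃o ℕ := ⟨w.1, hmono.le_iff_le⟩
  exact hw (ext_apply fun p => DFunLike.congr_fun (Subsingleton.elim e (OrderIso.refl ℕ)) p)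

theorem induction_on_descents {P : SInf → Prop}
    (h : ∀ w : SInf, (∀ a, w.1 (a + 1) < w.1 a → P (w.mulSwap a (a + 1))) → P w) (w : SInf) :
    P w := by
  induction hn : w.length using Nat.strong_induction_on generalizing w with
  | _ n ih =>
    refine h w fun a ha => ih _ ?_ _ rfl
    have := w.length_mulSwap_of_descent ha
    omega

/-- The permutation `w.mulSwap a b` covers `w` in the Bruhat order. The condition is the
combinatorial one: the value at `a` is smaller than the value at `b`, and no position in between
has a value in between. -/
def CoveredBySwap (w : SInf) (a b : ℕ) : Prop :=
  a < b ∧ w.1 a < w.1 b ∧ ∀ p, a < p → p < b → w.1 p < w.1 a ∨ w.1 b < w.1 p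

theorem CoveredBySwap.length_mulSwap {w : SInf} {a b : ℕ} (h : w.CoveredBySwap a b) :
    (w.mulSwap a b).length = w.length + 1 := by
  induction hd : b - (a + 1) generalizing w a with
  | zero =>
    obtain rfl : b = a + 1 := by
      have := h.1
      omega
    exact w.length_mulSwap_of_ascent h.2.1
  | succ d ih =>
    obtain ⟨-, hlt, hbetween⟩ := h
    have hb : b ≠ a ∧ b ≠ a + 1 := by omega
    have hconj : (w.mulSwap a b).mulSwap a (a + 1) = (w.mulSwap a (a + 1)).mulSwap (a + 1) b := by
      rw [mulSwap_mulSwap, Equiv.swap_apply_left, Equiv.swap_apply_of_ne_of_ne hb.1 hb.2]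
    have hcov : (w.mulSwap a (a + 1)).CoveredBySwap (a + 1) b := by
      refine ⟨by omega, ?_, fun p hp hpb => ?_⟩
      · rwa [mulSwap_apply_right, mulSwap_apply_of_ne _ hb.1 hb.2]
      · rw [mulSwap_apply_right, mulSwap_apply_of_ne _ hb.1 hb.2,
          mulSwap_apply_of_ne _ (by omega) (by omega)]
        exact hbetween p (by omega) hpb
    have hlen := ih hcov (by omega)
    rw [← hconj] at hlen
    have hleft := w.mulSwap_apply_left a b
    have hnext : (w.mulSwap a b).1 (a + 1) = w.1 (a + 1) :=
      w.mulSwap_apply_of_ne a.succ_ne_self hb.2.symm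
    rcases hbetween (a + 1) (by omega) (by omega) with hsmall | hbig
    · have := w.length_mulSwap_of_descent hsmall
      have := (w.mulSwap a b).length_mulSwap_of_descent (a := a) (by omega)
      omega
    · have := w.length_mulSwap_of_ascent (a := a) (by omega)
      have := (w.mulSwap a b).length_mulSwap_of_ascent (a := a) (by omega)
      omega

theorem prod_map_swap_concat (l : List ℕ) (a : ℕ) :
    ((l ++ [a]).map fun b => Equiv.swap b (b + 1)).prod =
      (l.map fun b => Equiv.swap b (b + 1)).prod * Equiv.swap a (a + 1) := by
  rw [List.map_append, List.prod_append, List.map_singleton, List.prod_singleton]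

theorem prod_map_swap_concat_eq_iff (w : SInf) (l : List ℕ) (a : ℕ) :
    ((l ++ [a]).map fun b => Equiv.swap b (b + 1)).prod = w.1 ↔
      (l.map fun b => Equiv.swap b (b + 1)).prod = (w.mulSwap a (a + 1)).1 := by
  rw [prod_map_swap_concat, ← eq_mul_inv_iff_mul_eq, Equiv.swap_inv]
  rfl

theorem length_le_of_prod_map_swap_eq {l : List ℕ} {w : SInf}
    (h : (l.map fun b => Equiv.swap b (b + 1)).prod = w.1) : w.length ≤ l.length := by
  induction l using List.reverseRecOn generalizing w with
  | nil =>
    obtain rfl : w = 1 := Subtype.ext h.symm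
    exact length_one.le
  | append_singleton l a ih =>
    have hlen := ih ((w.prod_map_swap_concat_eq_iff l a).1 h)
    rw [List.length_append, List.length_singleton]
    rcases w.ascent_or_descent a with ha | ha
    · have := w.length_mulSwap_of_ascent ha
      omega
    · have := w.length_mulSwap_of_descent ha
      omega

theorem nil_mem_reducedWords_iff {w : SInf} : [] ∈ w.reducedWords ↔ w = 1 := by
  refine ⟨fun h => Subtype.ext h.1.symm, ?_⟩
  rintro rfl
  exact ⟨rfl, length_one.symm⟩

theorem concat_mem_reducedWords_iff {w : SInf} {l : List ℕ} {a : ℕ} :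
    l ++ [a] ∈ w.reducedWords ↔
      w.1 (a + 1) < w.1 a ∧ l ∈ (w.mulSwap a (a + 1)).reducedWords := by
  simp only [reducedWords, Set.mem_ofPred_eq, prod_map_swap_concat_eq_iff, List.length_append,
    List.length_singleton]
  constructor
  · rintro ⟨hprod, hlen⟩
    have hle := length_le_of_prod_map_swap_eq hprod
    rcases w.ascent_or_descent a with ha | ha
    · have := w.length_mulSwap_of_ascent ha
      omega
    · have := w.length_mulSwap_of_descent ha
      exact ⟨ha, hprod, by omega⟩
  · rintro ⟨ha, hprod, hlen⟩
    have := w.length_mulSwap_of_descent ha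
    exact ⟨hprod, by omega⟩

theorem FixesFrom.lt_of_mem_reducedWord {N : ℕ} {w : SInf} (h : w.FixesFrom N) {l : List ℕ}
    (hl : l ∈ w.reducedWords) {a : ℕ} (ha : a ∈ l) : a < N := by
  induction l using List.reverseRecOn generalizing w with
  | nil => cases ha
  | append_singleton l b ih =>
    rw [concat_mem_reducedWords_iff] at hl
    have hb : b + 1 < N := h.lt_of_inversion b.lt_succ_self hl.1
    rcases List.mem_append.1 ha with hal | hab
    · exact ih (h.mulSwap (b.lt_succ_self.trans hb) hb) hl.2 hal
    · rw [List.mem_singleton.1 hab]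
      exact b.lt_succ_self.trans hb

theorem isChain_ne_of_mem_reducedWords {w : SInf} {l : List ℕ} (hl : l ∈ w.reducedWords) :
    l.IsChain (· ≠ ·) := by
  induction l using List.reverseRecOn generalizing w with
  | nil => exact List.isChain_nil
  | append_singleton l a ih =>
    rw [concat_mem_reducedWords_iff] at hl
    rw [List.isChain_append]
    refine ⟨ih hl.2, List.isChain_singleton _, ?_⟩
    rintro b hb c hc rfl
    obtain ⟨l', rfl⟩ := List.getLast?_eq_some_iff.1 hb
    obtain rfl : a = b := by simpa using hc
    rw [concat_mem_reducedWords_iff, mulSwap_apply_left, mulSwap_apply_right] at hl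
    exact hl.1.asymm hl.2.1

section NilCoxeter

variable {R A : Type*} [CommRing R] [Ring A] [Algebra R A]

/-- The relations of the nilCoxeter algebra of `S_∞`. -/
structure IsNilCoxeter (u : ℕ → A) : Prop where
  sq : ∀ a, u a * u a = 0
  comm : ∀ a b, a + 2 ≤ b → u a * u b = u b * u a
  braid : ∀ a, u a * u (a + 1) * u a = u (a + 1) * u a * u (a + 1)

/-- The factor `1 + x u_a`, which solves the Yang–Baxter equation when `u` satisfies the
nilCoxeter relations. -/
def nilFactor (u : ℕ → A) (a : ℕ) (x : R) : A := 1 + x • u a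

/-- The product of the factors `1 + x u_a` for `i ≤ a < i + d`, in increasing order of `a`. -/
def nilRow (u : ℕ → A) : ℕ → ℕ → R → A
  | _, 0, _ => 1
  | i, d + 1, x => nilFactor u i x * nilRow u (i + 1) d x

theorem nilFactor_zero (u : ℕ → A) (a : ℕ) : nilFactor u a (0 : R) = 1 := by
  rw [nilFactor, zero_smul, add_zero]

namespace IsNilCoxeter

variable {u : ℕ → A} (hu : IsNilCoxeter u)
include hu

theorem nilFactor_mul_nilFactor (a : ℕ) (x y : R) :
    nilFactor u a x * nilFactor u a y = nilFactor u a (x + y) := by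
  simp only [nilFactor, mul_add, add_mul, one_mul, mul_one, smul_mul_assoc, mul_smul_comm, hu.sq,
    smul_zero, add_zero, add_smul]
  abel

theorem yangBaxter (a : ℕ) (x y : R) :
    nilFactor u a x * nilFactor u (a + 1) (x + y) * nilFactor u a y =
      nilFactor u (a + 1) y * nilFactor u a (x + y) * nilFactor u (a + 1) x := by
  have hsq := hu.sq a
  have hsq' := hu.sq (a + 1)
  have hbraid := hu.braid a
  simp only [nilFactor]
  generalize u a = p, u (a + 1) = q at *
  simp only [mul_add, add_mul, one_mul, mul_one, smul_mul_assoc, mul_smul_comm, hsq, hsq', hbraid,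
    smul_zero, add_zero, add_smul, smul_add, smul_smul]
  module

theorem nilFactor_neg_mul_nilRow (i d : ℕ) (x : R) :
    nilFactor u i (-x) * nilRow u i (d + 1) x = nilRow u (i + 1) d x := by
  rw [nilRow, ← mul_assoc, hu.nilFactor_mul_nilFactor, neg_add_cancel, nilFactor_zero, one_mul]

theorem commute_nilRow {a i : ℕ} (d : ℕ) (h : a + 2 ≤ i) (x : R) :
    Commute (u a) (nilRow u i d x) := by
  induction d generalizing i with
  | zero => exact Commute.one_right _
  | succ d ih =>
    refine Commute.mul_right ?_ (ih (by omega))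
    exact (Commute.one_right _).add_right (Commute.smul_right (hu.comm a i h) x)

theorem nilFactor_commute_nilRow {a i : ℕ} (d : ℕ) (h : a + 2 ≤ i) (x y : R) :
    Commute (nilFactor u a x) (nilRow u i d y) :=
  (Commute.one_left _).add_left ((hu.commute_nilRow d h y).smul_left x)

theorem nilFactor_exchange (i : ℕ) (x y : R) :
    nilFactor u i x * nilFactor u (i + 1) x * nilFactor u i y * nilFactor u (i + 1) (-x) =
      nilFactor u i y * nilFactor u (i + 1) y * nilFactor u i x * nilFactor u (i + 1) (-y) := by
  have hyb := hu.yangBaxter i (x - y) y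
  rw [sub_add_cancel] at hyb
  calc _ = nilFactor u i y * (nilFactor u i (x - y) * nilFactor u (i + 1) x * nilFactor u i y) *
          nilFactor u (i + 1) (-x) := by
        rw [← add_sub_cancel y x, ← hu.nilFactor_mul_nilFactor, add_sub_cancel]
        simp only [mul_assoc]
    _ = nilFactor u i y * nilFactor u (i + 1) y * nilFactor u i x *
          (nilFactor u (i + 1) (x - y) * nilFactor u (i + 1) (-x)) := by
        rw [hyb]
        simp only [mul_assoc]
    _ = _ := by
        rw [hu.nilFactor_mul_nilFactor, show x - y + -x = -y by ring]

theorem nilRow_mul_nilRow (i d : ℕ) (x y : R) :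
    nilRow u i (d + 2) x * nilRow u i (d + 2) y =
      (nilFactor u i x * nilFactor u (i + 1) x * nilFactor u i y * nilFactor u (i + 1) (-x)) *
        (nilRow u (i + 1) (d + 1) x * nilRow u (i + 1) (d + 1) y) := by
  calc nilRow u i (d + 2) x * nilRow u i (d + 2) y
      = nilFactor u i x * nilFactor u (i + 1) x * (nilRow u (i + 2) d x * nilFactor u i y) *
          nilRow u (i + 1) (d + 1) y := by
        simp only [nilRow, mul_assoc]
    _ = nilFactor u i x * nilFactor u (i + 1) x * (nilFactor u i y *
          (nilFactor u (i + 1) (-x) * nilRow u (i + 1) (d + 1) x)) *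
          nilRow u (i + 1) (d + 1) y := by
        rw [← (hu.nilFactor_commute_nilRow d le_rfl y x).eq, hu.nilFactor_neg_mul_nilRow]
    _ = _ := by simp only [mul_assoc]

theorem nilRow_commute (i d : ℕ) (x y : R) : Commute (nilRow u i d x) (nilRow u i d y) := by
  induction d generalizing i with
  | zero => exact Commute.one_right _
  | succ d ih =>
    rcases d with - | d
    · simp only [nilRow, mul_one, Commute, SemiconjBy]
      rw [hu.nilFactor_mul_nilFactor, hu.nilFactor_mul_nilFactor, add_comm]
    · rw [Commute, SemiconjBy, hu.nilRow_mul_nilRow, hu.nilRow_mul_nilRow, hu.nilFactor_exchange,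
        (ih (i + 1)).eq]

end IsNilCoxeter

end NilCoxeter

section Functions

variable {R : Type*} [CommRing R]

/-- The action of the nilCoxeter generator `u_a` on families of scalars indexed by permutations. A
family `g` stands for the formal sum `∑ g(w) w`, on which `u_a` acts by right multiplication with
the transposition of `a` and `a + 1` if this increases the length, and by `0` otherwise. -/
def nilOp (R : Type*) [CommRing R] (a : ℕ) : Module.End R (SInf → R) where
  toFun g w := if w.1 (a + 1) < w.1 a then g (w.mulSwap a (a + 1)) else 0
  map_add' g g' := by
    ext w
    by_cases h : w.1 (a + 1) < w.1 a <;> simp [h]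
  map_smul' r g := by
    ext w
    by_cases h : w.1 (a + 1) < w.1 a <;> simp [h]

theorem nilOp_apply (a : ℕ) (g : SInf → R) (w : SInf) :
    nilOp R a g w = if w.1 (a + 1) < w.1 a then g (w.mulSwap a (a + 1)) else 0 := rfl

theorem mulSwap_braid (w : SInf) (a : ℕ) :
    ((w.mulSwap a (a + 1)).mulSwap (a + 1) (a + 2)).mulSwap a (a + 1) =
      ((w.mulSwap (a + 1) (a + 2)).mulSwap a (a + 1)).mulSwap (a + 1) (a + 2) := by
  refine ext_apply fun p => ?_
  simp only [mulSwap_apply_ite]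
  split_ifs <;> first | rfl | omega

theorem isNilCoxeter_nilOp : IsNilCoxeter (nilOp R) where
  sq a := by
    ext g w
    simp only [Module.End.mul_apply, nilOp_apply, mulSwap_apply_left, mulSwap_apply_right,
      LinearMap.zero_apply, Pi.zero_apply]
    split_ifs <;> first | rfl | omega
  comm a b h := by
    ext g w
    have hcomm := w.mulSwap_comm (a := a) (b := a + 1) (c := b) (d := b + 1) (by omega) (by omega)
      (by omega) (by omega)
    have hb := w.mulSwap_apply_of_ne (show b ≠ a by omega) (show b ≠ a + 1 by omega)
    have hb' := w.mulSwap_apply_of_ne (show b + 1 ≠ a by omega) (show b + 1 ≠ a + 1 by omega)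
    have ha := w.mulSwap_apply_of_ne (show a ≠ b by omega) (show a ≠ b + 1 by omega)
    have ha' := w.mulSwap_apply_of_ne (show a + 1 ≠ b by omega) (show a + 1 ≠ b + 1 by omega)
    simp only [Module.End.mul_apply, nilOp_apply, hb, hb', ha, ha', hcomm]
    split_ifs <;> rfl
  braid a := by
    ext g w
    simp only [Module.End.mul_apply, nilOp_apply, add_assoc, one_add_one_eq_two, mulSwap_braid]
    simp only [mulSwap_apply_ite, left_eq_add, add_eq_left, add_right_inj, OfNat.ofNat_ne_zero,
      one_ne_zero, OfNat.ofNat_ne_one, OfNat.one_ne_ofNat, if_true, if_false]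
    split_ifs <;> rfl

/-- The product of the rows `k - 1, …, 0`, row `i` having the parameter `x i` and the letters
`i, …, n - 1`. -/
def nilRows (n : ℕ) (x : ℕ → R) : ℕ → Module.End R (SInf → R)
  | 0 => 1
  | k + 1 => nilRow (nilOp R) k (n - k) (x k) * nilRows n x k

theorem nilFactor_nilOp_apply (a : ℕ) (x : R) (g : SInf → R) (w : SInf) :
    nilFactor (nilOp R) a x g w =
      g w + x * if w.1 (a + 1) < w.1 a then g (w.mulSwap a (a + 1)) else 0 := rfl

theorem comp_nilFactor (σ : R →+* R) (a : ℕ) (x : R) (g : SInf → R) :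
    σ ∘ nilFactor (nilOp R) a x g = nilFactor (nilOp R) a (σ x) (σ ∘ g) := by
  ext w
  simp only [Function.comp_apply, nilFactor_nilOp_apply, map_add, map_mul, apply_ite σ, map_zero]

theorem comp_nilRow (σ : R →+* R) (i d : ℕ) (x : R) (g : SInf → R) :
    σ ∘ nilRow (nilOp R) i d x g = nilRow (nilOp R) i d (σ x) (σ ∘ g) := by
  induction d generalizing i with
  | zero => rfl
  | succ d ih =>
    simp only [nilRow, Module.End.mul_apply]
    rw [comp_nilFactor, ih]

theorem comp_nilRows_eq_self {σ : R →+* R} {x : ℕ → R} {e : SInf → R} {k : ℕ}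
    (hx : ∀ i < k, σ (x i) = x i) (he : σ ∘ e = e) (n : ℕ) :
    σ ∘ nilRows n x k e = nilRows n x k e := by
  induction k with
  | zero => exact he
  | succ k ih =>
    simp only [nilRows, Module.End.mul_apply]
    rw [comp_nilRow, hx k k.lt_succ_self, ih fun i hi => hx i (hi.trans k.lt_succ_self)]

theorem nilRows_add_two {n i : ℕ} (hi : i < n) (x : ℕ → R) :
    nilRows n x (i + 2) = nilFactor (nilOp R) i (-x (i + 1)) *
      (nilRow (nilOp R) i (n - i) (x (i + 1)) * nilRow (nilOp R) i (n - i) (x i) *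
        nilRows n x i) := by
  obtain ⟨d, rfl⟩ := Nat.exists_eq_add_of_lt hi
  have hd : i + d + 1 - i = d + 1 := by omega
  have hd' : i + d + 1 - (i + 1) = d := by omega
  rw [← mul_assoc, ← mul_assoc, hd, isNilCoxeter_nilOp.nilFactor_neg_mul_nilRow, nilRows, nilRows,
    hd, hd', mul_assoc]

theorem nilRows_sub_comp_add_two {n i : ℕ} (hi : i < n) {x : ℕ → R} {σ : R →+* R} {e : SInf → R}
    (he : σ ∘ e = e) (hσ : σ (x i) = x (i + 1)) (hσ' : σ (x (i + 1)) = x i)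
    (hfix : ∀ k, k ≠ i → k ≠ i + 1 → σ (x k) = x k) :
    nilRows n x (i + 2) e - σ ∘ nilRows n x (i + 2) e =
      (x i - x (i + 1)) • nilOp R i (nilRows n x (i + 2) e) := by
  set Q := (nilRow (nilOp R) i (n - i) (x (i + 1)) * nilRow (nilOp R) i (n - i) (x i) *
    nilRows n x i) e with hQ
  have hrows : nilRows n x (i + 2) e = nilFactor (nilOp R) i (-x (i + 1)) Q := by
    rw [nilRows_add_two hi, Module.End.mul_apply]
  have hQσ : σ ∘ Q = Q := by
    have hprefix := comp_nilRows_eq_self (fun j hj => hfix j (by omega) (by omega)) he n (k := i)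
    have hswap := (isNilCoxeter_nilOp (R := R)).nilRow_commute i (n - i) (x i) (x (i + 1))
    rw [hQ, Module.End.mul_apply, Module.End.mul_apply, comp_nilRow, comp_nilRow, hprefix, hσ, hσ',
      ← Module.End.mul_apply, hswap.eq, Module.End.mul_apply]
  have hsq : nilOp R i (nilOp R i Q) = 0 :=
    LinearMap.congr_fun (isNilCoxeter_nilOp.sq i) Q
  rw [hrows, comp_nilFactor, hQσ]
  simp only [nilFactor, LinearMap.add_apply, LinearMap.smul_apply, Module.End.one_apply, map_add,
    map_smul, hsq, map_neg, hσ']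
  module

/-- The later rows commute with `u_i` and are fixed by `σ`, so the divided difference of the product
is determined by the rows up to `i + 1`. -/
theorem nilRows_sub_comp {n i k : ℕ} (hi : i < n) (hk : i + 2 ≤ k) {x : ℕ → R} {σ : R →+* R}
    {e : SInf → R} (he : σ ∘ e = e) (hσ : σ (x i) = x (i + 1)) (hσ' : σ (x (i + 1)) = x i)
    (hfix : ∀ k, k ≠ i → k ≠ i + 1 → σ (x k) = x k) :
    nilRows n x k e - σ ∘ nilRows n x k e =
      (x i - x (i + 1)) • nilOp R i (nilRows n x k e) := by
  induction k, hk using Nat.le_induction with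
  | base => exact nilRows_sub_comp_add_two hi he hσ hσ' hfix
  | succ k hk ih =>
    simp only [nilRows, Module.End.mul_apply]
    rw [comp_nilRow, hfix k (by omega) (by omega), ← map_sub, ih, map_smul]
    congr 1
    exact LinearMap.congr_fun (isNilCoxeter_nilOp.commute_nilRow (n - k) hk (x k)).eq.symm _

end Functions

open MvPolynomial

/-- The order in which the pairs (row, letter) enter the generating function: rows increase, and
letters decrease within a row. -/
def PairLT (p q : ℕ × ℕ) : Prop := p.1 < q.1 ∨ (p.1 = q.1 ∧ q.2 < p.2)

instance : Trans PairLT PairLT PairLT where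
  trans {p q r} hpq hqr := by
    unfold PairLT at *
    omega

instance : Std.Antisymm PairLT where
  antisymm p q hpq hqp := by
    unfold PairLT at *
    omega

instance : Std.Irrefl PairLT where
  irrefl p hp := by
    unfold PairLT at hp
    omega

/-- The pairs `(r, a)` for `i ≤ a < i + d`, in decreasing order of `a`. -/
def rowPairs (r : ℕ) : ℕ → ℕ → List (ℕ × ℕ)
  | _, 0 => []
  | i, d + 1 => rowPairs r (i + 1) d ++ [(r, i)]

/-- The pairs `(r, a)` for `r < k` and `r ≤ a < n`, in the order `PairLT`. -/
def gridPairs (n : ℕ) : ℕ → List (ℕ × ℕ)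
  | 0 => []
  | k + 1 => gridPairs n k ++ rowPairs k k (n - k)

theorem mem_rowPairs {r i d : ℕ} {p : ℕ × ℕ} :
    p ∈ rowPairs r i d ↔ p.1 = r ∧ i ≤ p.2 ∧ p.2 < i + d := by
  obtain ⟨s, a⟩ := p
  induction d generalizing i with
  | zero =>
    simp only [rowPairs, List.not_mem_nil, false_iff]
    omega
  | succ d ih =>
    simp only [rowPairs, List.mem_append, ih, List.mem_singleton, Prod.mk.injEq]
    omega

theorem mem_gridPairs {n k : ℕ} {p : ℕ × ℕ} :
    p ∈ gridPairs n k ↔ p.1 < k ∧ p.1 ≤ p.2 ∧ p.2 < n := by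
  obtain ⟨s, a⟩ := p
  induction k with
  | zero => simp only [gridPairs, List.not_mem_nil, Nat.not_lt_zero, false_and]
  | succ k ih =>
    simp only [gridPairs, List.mem_append, ih, mem_rowPairs]
    omega

theorem pairwise_rowPairs (r i d : ℕ) : (rowPairs r i d).Pairwise PairLT := by
  induction d generalizing i with
  | zero => exact List.Pairwise.nil
  | succ d ih =>
    rw [rowPairs, List.pairwise_append]
    refine ⟨ih _, List.pairwise_singleton _ _, fun p hp q hq => ?_⟩
    rw [mem_rowPairs] at hp
    obtain rfl := List.mem_singleton.1 hq
    exact Or.inr ⟨hp.1, hp.2.1⟩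

theorem pairwise_gridPairs (n k : ℕ) : (gridPairs n k).Pairwise PairLT := by
  induction k with
  | zero => exact List.Pairwise.nil
  | succ k ih =>
    rw [gridPairs, List.pairwise_append]
    refine ⟨ih, pairwise_rowPairs _ _ _, fun p hp q hq => Or.inl ?_⟩
    rw [(mem_rowPairs.1 hq).1]
    exact (mem_gridPairs.1 hp).1

theorem sublist_gridPairs_iff {n k : ℕ} {l : List (ℕ × ℕ)} :
    l.Sublist (gridPairs n k) ↔
      l.Pairwise PairLT ∧ ∀ p ∈ l, p.1 < k ∧ p.1 ≤ p.2 ∧ p.2 < n := by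
  constructor
  · exact fun h =>
      ⟨(pairwise_gridPairs n k).sublist h, fun p hp => mem_gridPairs.1 (h.subset hp)⟩
  · rintro ⟨hpairwise, hmem⟩
    exact List.sublist_of_subperm_of_pairwise (r := PairLT)
      (hpairwise.nodup.subperm fun p hp => mem_gridPairs.2 (hmem p hp)) hpairwise
      (pairwise_gridPairs n k)

theorem gridPairs_add (n d : ℕ) : gridPairs n (n + d) = gridPairs n n := by
  induction d with
  | zero => rfl
  | succ d ih =>
    rw [← add_assoc, gridPairs, ih, Nat.sub_eq_zero_of_le (Nat.le_add_right n d), rowPairs,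
      List.append_nil]

open Classical in
/-- The sublists `(i₁, a₁), …, (i_p, a_p)` of `L` for which `a₁ ⋯ a_p` is a reduced word of `w`. -/
noncomputable def reducedSublists (L : List (ℕ × ℕ)) (w : SInf) : List (List (ℕ × ℕ)) :=
  L.sublists.filter fun l => l.map Prod.snd ∈ w.reducedWords

/-- The sum of `x_{i₁} ⋯ x_{i_p}` over the sublists `(i₁, a₁), …, (i_p, a_p)` of `L` for which
`a₁ ⋯ a_p` is a reduced word of `w`. For a suitable `L` this is the Schubert polynomial of `w`. -/
noncomputable def wordSum (L : List (ℕ × ℕ)) (w : SInf) : MvPolynomial ℕ ℤ :=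
  ((reducedSublists L w).map fun l => (l.map fun p => X p.1).prod).sum

theorem mem_reducedSublists {L l : List (ℕ × ℕ)} {w : SInf} :
    l ∈ reducedSublists L w ↔ l.Sublist L ∧ l.map Prod.snd ∈ w.reducedWords := by
  classical
  rw [reducedSublists, List.mem_filter, List.mem_sublists, decide_eq_true_iff]

theorem reducedSublists_concat (L : List (ℕ × ℕ)) (p : ℕ × ℕ) (w : SInf) :
    reducedSublists (L ++ [p]) w = reducedSublists L w ++
      if w.1 (p.2 + 1) < w.1 p.2 then
        (reducedSublists L (w.mulSwap p.2 (p.2 + 1))).map (· ++ [p]) else [] := by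
  classical
  simp only [reducedSublists, List.sublists_concat, List.filter_append, List.filter_map]
  congr 1
  have hconcat (l : List (ℕ × ℕ)) : (l ++ [p]).map Prod.snd ∈ w.reducedWords ↔
      w.1 (p.2 + 1) < w.1 p.2 ∧ l.map Prod.snd ∈ (w.mulSwap p.2 (p.2 + 1)).reducedWords := by
    rw [List.map_append, List.map_singleton, concat_mem_reducedWords_iff]
  simp only [Function.comp_def, hconcat]
  split_ifs with h
  · simp only [h, true_and]
  · simp only [h, false_and, decide_false, List.filter_false, List.map_nil]

theorem wordSum_concat (L : List (ℕ × ℕ)) (p : ℕ × ℕ) :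
    wordSum (L ++ [p]) = nilFactor (nilOp (MvPolynomial ℕ ℤ)) p.2
      (X p.1 : MvPolynomial ℕ ℤ) (wordSum L) := by
  ext1 w
  rw [nilFactor_nilOp_apply, wordSum, reducedSublists_concat, List.map_append, List.sum_append]
  congr 1
  split_ifs with h
  · simp only [wordSum, List.map_map, Function.comp_def, List.map_append, List.map_singleton,
      List.prod_append, List.prod_singleton, mul_comm _ (X p.1), List.sum_map_mul_left]
  · rw [List.map_nil, List.sum_nil, mul_zero]

theorem wordSum_append_rowPairs (L : List (ℕ × ℕ)) (r i d : ℕ) :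
    wordSum (L ++ rowPairs r i d) =
      nilRow (nilOp (MvPolynomial ℕ ℤ)) i d (X r : MvPolynomial ℕ ℤ) (wordSum L) := by
  induction d generalizing i with
  | zero => rw [rowPairs, List.append_nil, nilRow, Module.End.one_apply]
  | succ d ih =>
    rw [rowPairs, ← List.append_assoc, wordSum_concat, ih]
    rfl

theorem wordSum_gridPairs (n k : ℕ) :
    wordSum (gridPairs n k) = nilRows n (X : ℕ → MvPolynomial ℕ ℤ) k (wordSum []) := by
  induction k with
  | zero => rfl
  | succ k ih =>
    rw [gridPairs, wordSum_append_rowPairs, ih]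
    rfl

open Classical in
theorem wordSum_nil (w : SInf) : wordSum [] w = if w = 1 then 1 else 0 := by
  rw [wordSum, reducedSublists, List.sublists_nil, List.filter_singleton, List.map_nil]
  by_cases hw : w = 1 <;> simp [nil_mem_reducedWords_iff, hw]

theorem map_fst_mem_compatible_iff {l : List (ℕ × ℕ)} :
    l.map Prod.fst ∈ compatible (l.map Prod.snd) ↔
      l.IsChain (fun p q => p.1 ≤ q.1 ∧ (p.2 < q.2 → p.1 < q.1)) ∧ ∀ p ∈ l, p.1 ≤ p.2 := by
  have hgetD (f : ℕ × ℕ → ℕ) (t : ℕ) (ht : t < l.length) : (l.map f).getD t 0 = f l[t] := by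
    rw [List.getD_eq_getElem _ _ (by rwa [List.length_map]), List.getElem_map]
  simp only [compatible, Set.mem_ofPred_eq, List.length_map, true_and, List.isChain_iff_getElem,
    List.forall_mem_iff_forall_getElem]
  constructor
  · rintro ⟨hle, hbound, hlt⟩
    refine ⟨fun t ht => ⟨?_, fun h => ?_⟩, fun t ht => ?_⟩
    · simpa only [hgetD, ht, t.lt_succ_self.trans ht] using hle t ht
    · simpa only [hgetD, ht, t.lt_succ_self.trans ht, h, forall_const] using hlt t ht
    · simpa only [hgetD, ht] using hbound t ht
  · rintro ⟨hchain, hbound⟩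
    refine ⟨fun t ht => ?_, fun t ht => ?_, fun t ht h => ?_⟩
    · simpa only [hgetD, ht, t.lt_succ_self.trans ht] using (hchain t ht).1
    · simpa only [hgetD, ht] using hbound t ht
    · simp only [hgetD, ht, t.lt_succ_self.trans ht] at h ⊢
      exact (hchain t ht).2 h

/-- Adjacent letters of a reduced word are distinct, so that compatibility amounts to being strictly
increasing for `PairLT`. -/
theorem map_fst_mem_compatible_iff_sublist {n : ℕ} {w : SInf} (hw : w.FixesFrom n)
    {l : List (ℕ × ℕ)} (hl : l.map Prod.snd ∈ w.reducedWords) :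
    l.map Prod.fst ∈ compatible (l.map Prod.snd) ↔ l.Sublist (gridPairs n n) := by
  have hne := (List.isChain_map _).1 (isChain_ne_of_mem_reducedWords hl)
  have hlt (p : ℕ × ℕ) (hp : p ∈ l) : p.2 < n :=
    hw.lt_of_mem_reducedWord hl (List.mem_map_of_mem hp)
  rw [map_fst_mem_compatible_iff, sublist_gridPairs_iff, ← List.isChain_iff_pairwise]
  refine and_congr ?_ (forall₂_congr fun p hp => ?_)
  · rw [List.isChain_iff_getElem] at hne
    simp only [List.isChain_iff_getElem, PairLT]
    refine forall₂_congr fun t ht => ?_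
    have := hne t ht
    omega
  · have := hlt p hp
    omega

theorem bijOn_map_fst_reducedSublists {n : ℕ} {w : SInf} (hw : w.FixesFrom n) {a : List ℕ}
    (ha : a ∈ w.reducedWords) :
    Set.BijOn (List.map Prod.fst)
      {l | l ∈ reducedSublists (gridPairs n n) w ∧ l.map Prod.snd = a} (compatible a) := by
  refine ⟨?_, ?_, fun b hb => ⟨b.zip a, ⟨?_, List.map_snd_zip hb.1.ge⟩, List.map_fst_zip hb.1.le⟩⟩
  · rintro l ⟨hl, rfl⟩
    exact (map_fst_mem_compatible_iff_sublist hw ha).2 (mem_reducedSublists.1 hl).1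
  · rintro l ⟨-, rfl⟩ l' ⟨-, hl'⟩ heq
    exact (List.zip_of_prod rfl rfl).trans (List.zip_of_prod heq.symm hl').symm
  · have hsnd : (b.zip a).map Prod.snd = a := List.map_snd_zip hb.1.ge
    have hfst : (b.zip a).map Prod.fst = b := List.map_fst_zip hb.1.le
    have hred : (b.zip a).map Prod.snd ∈ w.reducedWords := by rwa [hsnd]
    refine mem_reducedSublists.2 ⟨(map_fst_mem_compatible_iff_sublist hw hred).1 ?_, hred⟩
    rwa [hsnd, hfst]

open Classical in
theorem finsum_mem_compatible {n : ℕ} {w : SInf} (hw : w.FixesFrom n) {a : List ℕ}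
    (ha : a ∈ w.reducedWords) :
    ∑ᶠ b ∈ compatible a, (b.map (X : ℕ → MvPolynomial ℕ ℤ)).prod =
      ∑ l ∈ (reducedSublists (gridPairs n n) w).toFinset with l.map Prod.snd = a,
        (l.map fun p => X p.1).prod := by
  rw [← finsum_mem_coe_finset]
  refine (finsum_mem_eq_of_bijOn (List.map Prod.fst) ?_ fun l _ => ?_).symm
  · simpa only [Finset.coe_filter, List.mem_toFinset] using bijOn_map_fst_reducedSublists hw ha
  · rw [List.map_map]
    rfl

theorem schubert_eq_wordSum {n : ℕ} {w : SInf} (hw : w.FixesFrom n) :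
    w.schubert = wordSum (gridPairs n n) w := by
  classical
  set Q := (reducedSublists (gridPairs n n) w).toFinset with hQ
  have hnodup : (reducedSublists (gridPairs n n) w).Nodup :=
    (List.nodup_sublists.2 (pairwise_gridPairs n n).nodup).filter _
  have hsub : ∀ a ∈ Q.image (List.map Prod.snd), a ∈ w.reducedWords := by
    simp only [Finset.forall_mem_image, hQ, List.mem_toFinset, mem_reducedSublists]
    exact fun l hl => hl.2
  calc w.schubert = ∑ᶠ a ∈ w.reducedWords,
        ∑ l ∈ Q with l.map Prod.snd = a, (l.map fun p => X p.1).prod :=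
        finsum_mem_congr rfl fun a ha => finsum_mem_compatible hw ha
    _ = ∑ a ∈ Q.image (List.map Prod.snd),
        ∑ l ∈ Q with l.map Prod.snd = a, (l.map fun p => X p.1).prod := by
      refine finsum_mem_eq_sum_of_inter_support_eq _ (Set.ext fun a => ?_)
      refine and_congr_left fun hne => ⟨fun _ => ?_, hsub a⟩
      obtain ⟨l, hl, -⟩ := Finset.exists_ne_zero_of_sum_ne_zero hne
      obtain ⟨hlQ, rfl⟩ := Finset.mem_filter.1 hl
      exact Finset.mem_image_of_mem _ hlQ
    _ = ∑ l ∈ Q, (l.map fun p => X p.1).prod :=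
      Finset.sum_fiberwise_of_maps_to (fun l hl => Finset.mem_image_of_mem _ hl) _
    _ = wordSum (gridPairs n n) w := List.sum_toFinset _ hnodup

theorem schubert_eq_nilRows {n : ℕ} {w : SInf} (hw : w.FixesFrom n) :
    w.schubert = nilRows n (X : ℕ → MvPolynomial ℕ ℤ) (n + 2) (wordSum []) w := by
  rw [schubert_eq_wordSum hw, ← gridPairs_add n 2, wordSum_gridPairs]

/-- The action of the transposition of `a` and `a + 1` on polynomials. -/
noncomputable def swapVar (a : ℕ) : MvPolynomial ℕ ℤ →ₐ[ℤ] MvPolynomial ℕ ℤ :=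
  rename (Equiv.swap a (a + 1))

theorem swapVar_X (a k : ℕ) : swapVar a (X k) = X (Equiv.swap a (a + 1) k) := rename_X _ _

theorem schubert_sub_swapVar (w : SInf) (a : ℕ) :
    w.schubert - swapVar a w.schubert = (X a - X (a + 1)) *
      if w.1 (a + 1) < w.1 a then (w.mulSwap a (a + 1)).schubert else 0 := by
  obtain ⟨n, hn, hw⟩ := w.exists_fixesFrom_ge (a + 2)
  let σ : MvPolynomial ℕ ℤ →+* MvPolynomial ℕ ℤ := swapVar a
  have hconst : σ ∘ wordSum [] = wordSum [] := by
    classical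
    ext1 v
    rw [Function.comp_apply, wordSum_nil, apply_ite σ, map_one, map_zero]
  have hdiff := congrFun (nilRows_sub_comp (n := n) (k := n + 2) (i := a) (x := X) (by omega)
    (by omega) hconst ((swapVar_X a a).trans (by rw [Equiv.swap_apply_left]))
    ((swapVar_X a (a + 1)).trans (by rw [Equiv.swap_apply_right]))
    fun k hk hk' => (swapVar_X a k).trans (by rw [Equiv.swap_apply_of_ne_of_ne hk hk'])) w
  have hw' : (w.mulSwap a (a + 1)).FixesFrom n := hw.mulSwap (by omega) (by omega)
  rw [schubert_eq_nilRows hw, schubert_eq_nilRows hw']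
  exact hdiff

theorem prod_map_X (l : List (ℕ × ℕ)) :
    (l.map fun p => (X p.1 : MvPolynomial ℕ ℤ)).prod =
      monomial (l.map fun p => Finsupp.single p.1 1).sum 1 := by
  induction l with
  | nil => rfl
  | cons p l ih =>
    rw [List.map_cons, List.prod_cons, ih, List.map_cons, List.sum_cons, X, monomial_mul, one_mul]

theorem isHomogeneous_schubert (w : SInf) : w.schubert.IsHomogeneous w.length := by
  obtain ⟨n, hn⟩ := w.exists_fixesFrom
  rw [schubert_eq_wordSum hn, wordSum]
  refine list_sum_mem (S := homogeneousSubmodule ℕ ℤ w.length) fun f hf => ?_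
  obtain ⟨l, hl, rfl⟩ := List.mem_map.1 hf
  have hlen : l.length = w.length := by
    rw [← (mem_reducedSublists.1 hl).2.2, List.length_map]
  rw [mem_homogeneousSubmodule, prod_map_X, ← hlen]
  refine isHomogeneous_monomial _ ?_
  rw [map_list_sum, List.map_map]
  simp [Function.comp_def]

theorem coeff_schubert_nonneg (w : SInf) (d : ℕ →₀ ℕ) : 0 ≤ coeff d w.schubert := by
  obtain ⟨n, hn⟩ := w.exists_fixesFrom
  rw [schubert_eq_wordSum hn, wordSum, ← lcoeff_apply, map_list_sum, List.map_map]
  refine List.sum_nonneg fun c hc => ?_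
  obtain ⟨l, -, rfl⟩ := List.mem_map.1 hc
  rw [Function.comp_apply, lcoeff_apply, prod_map_X, coeff_monomial]
  split_ifs
  · exact zero_le_one
  · exact le_rfl

theorem schubert_one : (1 : SInf).schubert = 1 := by
  classical
  rw [schubert_eq_wordSum (n := 0) fun _ _ => rfl, gridPairs, wordSum_nil, if_pos rfl]

theorem CoveredBySwap.ascent_mulSwap {w : SInf} {p q a : ℕ} (h : w.CoveredBySwap p q)
    (ha : w.1 a < w.1 (a + 1)) (hne : ¬(p = a ∧ q = a + 1)) :
    (w.mulSwap p q).1 a < (w.mulSwap p q).1 (a + 1) := by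
  obtain ⟨hpq, hlt, hbetween⟩ := h
  have hbetween_a := hbetween a
  have hbetween_succ := hbetween (a + 1)
  simp only [mulSwap_apply_ite]
  split_ifs <;> subst_vars <;> omega

theorem coveredBySwap_mulSwap_adjacent_iff {w : SInf} {p q a : ℕ} (hpq : p < q)
    (hne : ¬(p = a ∧ q = a + 1)) :
    (w.mulSwap a (a + 1)).CoveredBySwap (Equiv.swap a (a + 1) p) (Equiv.swap a (a + 1) q) ↔
      w.1 p < w.1 q ∧ ∀ x, Equiv.swap a (a + 1) p < Equiv.swap a (a + 1) x →
        Equiv.swap a (a + 1) x < Equiv.swap a (a + 1) q → w.1 x < w.1 p ∨ w.1 q < w.1 x := by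
  simp only [CoveredBySwap, mulSwap_apply, Equiv.swap_apply_self,
    swap_adjacent_lt_swap_adjacent hpq hne, true_and]
  refine and_congr_right fun _ => ⟨fun h x hx hx' => ?_, fun h x hx hx' => h _ ?_ ?_⟩
  · have hx'' := h _ hx hx'
    rwa [Equiv.swap_apply_self] at hx''
  · rwa [Equiv.swap_apply_self]
  · rwa [Equiv.swap_apply_self]

theorem coveredBySwap_mulSwap_adjacent_iff_of_descent {w : SInf} {p q a : ℕ}
    (ha : w.1 (a + 1) < w.1 a) (hpq : p < q) (hne : ¬(p = a ∧ q = a + 1)) :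
    (w.mulSwap a (a + 1)).CoveredBySwap (Equiv.swap a (a + 1) p) (Equiv.swap a (a + 1) q) ↔
      w.CoveredBySwap p q ∧ (w.mulSwap p q).1 (a + 1) < (w.mulSwap p q).1 a := by
  rw [coveredBySwap_mulSwap_adjacent_iff hpq hne]
  simp only [CoveredBySwap, mulSwap_apply_ite]
  constructor
  · rintro ⟨hlt, hbetween⟩
    have hbetween_a := hbetween a
    have hbetween_succ := hbetween (a + 1)
    refine ⟨⟨hpq, hlt, fun x hx hx' => ?_⟩, ?_⟩
    · have hbetween_x := hbetween x
      simp only [Equiv.swap_apply_def] at hbetween_x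
      split_ifs at hbetween_x <;> subst_vars <;> omega
    · simp only [Equiv.swap_apply_def] at hbetween_a hbetween_succ
      split_ifs at hbetween_a hbetween_succ ⊢ <;> subst_vars <;> omega
  · rintro ⟨⟨-, hlt, hbetween⟩, hdesc⟩
    refine ⟨hlt, fun x hx hx' => ?_⟩
    have hbetween_x := hbetween x
    simp only [Equiv.swap_apply_def] at hx hx'
    split_ifs at hx hx' hdesc <;> subst_vars <;> omega

theorem CoveredBySwap.comm {w : SInf} {a b c d : ℕ} (hac : a ≠ c) (had : a ≠ d) (hbc : b ≠ c)
    (hbd : b ≠ d) (h : w.CoveredBySwap a b) (h' : (w.mulSwap a b).CoveredBySwap c d) :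
    w.CoveredBySwap c d ∧ (w.mulSwap c d).CoveredBySwap a b := by
  obtain ⟨hab, hlt, hbetween⟩ := h
  obtain ⟨hcd, hlt', hbetween'⟩ := h'
  have hbetween_a := hbetween' a
  have hbetween_b := hbetween' b
  have hbetween_c := hbetween c
  have hbetween_d := hbetween d
  have := w.apply_ne_apply hac
  have := w.apply_ne_apply had
  have := w.apply_ne_apply hbc
  have := w.apply_ne_apply hbd
  simp only [mulSwap_apply_ite, hac.symm, had.symm, hbc.symm, hbd.symm, if_false, if_true]
    at hlt' hbetween' hbetween_a hbetween_b
  constructor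
  · refine ⟨hcd, hlt', fun x hx hx' => ?_⟩
    have hbetween_x := hbetween' x hx hx'
    grind
  · simp only [CoveredBySwap, mulSwap_apply_ite]
    refine ⟨hab, by grind, fun x hx hx' => ?_⟩
    have hbetween_x := hbetween x hx hx'
    grind

theorem coveredBySwap_chain_iff_of_lt {w : SInf} {a m b : ℕ} (ham : a < m) (hmb : m < b)
    (h : w.1 a < w.1 m) :
    (w.CoveredBySwap m b ∧ (w.mulSwap m b).CoveredBySwap a m) ↔
      (w.CoveredBySwap a m ∧ (w.mulSwap a m).CoveredBySwap a b) := by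
  simp only [CoveredBySwap, mulSwap_apply_ite]
  constructor
  · rintro ⟨⟨-, hlt, hbetween⟩, -, -, hbetween'⟩
    refine ⟨⟨ham, h, fun x hx hx' => ?_⟩, by omega, by grind, fun x hx hx' => ?_⟩
    · have hbetween'_x := hbetween' x hx hx'
      grind
    · have hbetween_x := hbetween x
      have hbetween'_x := hbetween' x
      grind
  · rintro ⟨⟨-, -, hbetween⟩, -, hlt', hbetween'⟩
    refine ⟨⟨hmb, by grind, fun x hx hx' => ?_⟩, ham, by grind, fun x hx hx' => ?_⟩
    · have hbetween'_x := hbetween' x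
      grind
    · have hbetween_x := hbetween x
      have hbetween'_x := hbetween' x
      grind

theorem coveredBySwap_chain_iff_of_gt {w : SInf} {a m b : ℕ} (ham : a < m) (hmb : m < b)
    (h : w.1 m < w.1 a) :
    (w.CoveredBySwap m b ∧ (w.mulSwap m b).CoveredBySwap a m) ↔
      (w.CoveredBySwap a b ∧ (w.mulSwap a b).CoveredBySwap m b) := by
  simp only [CoveredBySwap, mulSwap_apply_ite]
  constructor
  · rintro ⟨⟨-, -, hbetween⟩, -, hlt', hbetween'⟩
    refine ⟨⟨by omega, by grind, fun x hx hx' => ?_⟩, hmb, by grind, fun x hx hx' => ?_⟩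
    · have hbetween_x := hbetween x
      have hbetween'_x := hbetween' x
      grind
    · have hbetween_x := hbetween x
      grind
  · rintro ⟨⟨-, hlt, hbetween⟩, -, -, hbetween'⟩
    refine ⟨⟨hmb, by grind, fun x hx hx' => ?_⟩, ham, by grind, fun x hx hx' => ?_⟩
    · have hbetween_x := hbetween x
      have hbetween'_x := hbetween' x
      grind
    · have hbetween_x := hbetween x
      grind

/-- The linear combination of Schubert polynomials with given coefficients. -/
noncomputable def expand : (SInf →₀ ℤ) →ₗ[ℤ] MvPolynomial ℕ ℤ :=
  Finsupp.linearCombination ℤ schubert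

theorem expand_single (w : SInf) (r : ℤ) : expand (Finsupp.single w r) = r • w.schubert :=
  Finsupp.linearCombination_single ℤ r w

theorem isSchubertExpansion_iff {f : MvPolynomial ℕ ℤ} {c : SInf →₀ ℤ} :
    IsSchubertExpansion f c ↔ f = expand c := by
  rw [IsSchubertExpansion, expand, Finsupp.linearCombination_apply, Finsupp.sum]
  simp only [smul_eq_C_mul]

theorem constantCoeff_schubert {w : SInf} (hw : w ≠ 1) : constantCoeff w.schubert = 0 := by
  obtain ⟨a, ha⟩ := exists_descent hw
  have hlength := w.length_mulSwap_of_descent ha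
  refine w.isHomogeneous_schubert.coeff_eq_zero (d := 0) ?_
  rw [map_zero]
  omega

theorem constantCoeff_expand (c : SInf →₀ ℤ) : constantCoeff (expand c) = c 1 := by
  induction c using Finsupp.induction_linear with
  | zero => rw [map_zero, map_zero, Finsupp.zero_apply]
  | add c d hc hd => rw [map_add, map_add, hc, hd, Finsupp.add_apply]
  | single w r =>
    rw [expand_single, smul_eq_C_mul, map_mul, constantCoeff_C]
    by_cases hw : w = 1
    · rw [hw, schubert_one, map_one, mul_one, Finsupp.single_eq_same]
    · rw [constantCoeff_schubert hw, Finsupp.single_eq_of_ne (Ne.symm hw), mul_zero]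

theorem succ_mem_vars_of_swapVar_eq {f : MvPolynomial ℕ ℤ} {k : ℕ} (h : swapVar k f = f)
    (hk : k ∈ f.vars) : k + 1 ∈ f.vars := by
  have hsub : f.vars ⊆ f.vars.image (Equiv.swap k (k + 1)) := by
    conv_lhs => rw [← h]
    exact vars_rename _ f
  obtain ⟨x, hx, hxk⟩ := Finset.mem_image.1 (hsub hk)
  rwa [(Equiv.swap_apply_eq_iff.1 hxk).trans (Equiv.swap_apply_left k (k + 1))] at hx

theorem eq_C_of_forall_swapVar_eq {f : MvPolynomial ℕ ℤ} (h : ∀ a, swapVar a f = f) :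
    f = C (constantCoeff f) := by
  refine vars_eq_empty_iff_eq_C.1 (Finset.not_nonempty_iff_eq_empty.1 fun hne => ?_)
  have hsucc := succ_mem_vars_of_swapVar_eq (h _) (f.vars.max'_mem hne)
  exact (f.vars.le_max' _ hsucc).not_gt (Nat.lt_succ_self _)

theorem eq_of_forall_sub_swapVar_eq {f g : MvPolynomial ℕ ℤ}
    (h : ∀ a, f - swapVar a f = g - swapVar a g) (hconst : constantCoeff f = constantCoeff g) :
    f = g := by
  have hinvariant (a : ℕ) : swapVar a (f - g) = f - g := by
    rw [map_sub]
    linear_combination -h a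
  rw [← sub_eq_zero, eq_C_of_forall_swapVar_eq hinvariant, map_sub, hconst, sub_self, map_zero]

/-- The divided difference operator `∂_a : f ↦ (f - s_a f) / (x_a - x_{a+1})`, acting on the
coefficients of an expansion into Schubert polynomials. -/
noncomputable def divDiff (a : ℕ) : (SInf →₀ ℤ) →ₗ[ℤ] (SInf →₀ ℤ) :=
  Finsupp.linearCombination ℤ fun w =>
    if w.1 (a + 1) < w.1 a then Finsupp.single (w.mulSwap a (a + 1)) 1 else 0

theorem divDiff_single (a : ℕ) (w : SInf) (r : ℤ) :
    divDiff a (Finsupp.single w r) =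
      if w.1 (a + 1) < w.1 a then Finsupp.single (w.mulSwap a (a + 1)) r else 0 := by
  rw [divDiff, Finsupp.linearCombination_single, smul_ite, Finsupp.smul_single_one, smul_zero]

theorem expand_sub_swapVar_expand (a : ℕ) (c : SInf →₀ ℤ) :
    expand c - swapVar a (expand c) = (X a - X (a + 1)) * expand (divDiff a c) := by
  induction c using Finsupp.induction_linear with
  | zero => simp only [map_zero, sub_zero, mul_zero]
  | add c d hc hd =>
    simp only [map_add, mul_add, ← hc, ← hd]
    ring
  | single w r =>
    rw [expand_single, map_smul, ← smul_sub, schubert_sub_swapVar, divDiff_single]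
    split_ifs
    · rw [expand_single, mul_smul_comm]
    · rw [mul_zero, smul_zero, map_zero, mul_zero]

theorem expand_divDiff_eq_of_sub_swapVar_eq {a : ℕ} {c : SInf →₀ ℤ} {g : MvPolynomial ℕ ℤ}
    (h : expand c - swapVar a (expand c) = (X a - X (a + 1)) * g) : expand (divDiff a c) = g := by
  have hX : (X a - X (a + 1) : MvPolynomial ℕ ℤ) ≠ 0 :=
    sub_ne_zero.2 ((X_injective (R := ℤ)).ne a.succ_ne_self.symm)
  exact mul_left_cancel₀ hX ((expand_sub_swapVar_expand a c).symm.trans h)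

theorem divDiff_apply_mulSwap {v : SInf} {a : ℕ} (ha : v.1 (a + 1) < v.1 a) (c : SInf →₀ ℤ) :
    divDiff a c (v.mulSwap a (a + 1)) = c v := by
  induction c using Finsupp.induction_linear with
  | zero => simp only [map_zero, Finsupp.zero_apply]
  | add c d hc hd => simp only [map_add, Finsupp.add_apply, hc, hd]
  | single w r =>
    rw [divDiff_single]
    by_cases hvw : w = v
    · rw [hvw, if_pos ha, Finsupp.single_eq_same, Finsupp.single_eq_same]
    · have hvw' : v.mulSwap a (a + 1) ≠ w.mulSwap a (a + 1) := fun h => hvw <| by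
        rw [← mulSwap_mulSwap_self w a (a + 1), ← h, mulSwap_mulSwap_self]
      rw [Finsupp.single_eq_of_ne (Ne.symm hvw)]
      split_ifs
      · rw [Finsupp.single_eq_of_ne hvw']
      · rw [Finsupp.zero_apply]

theorem expand_injective : Function.Injective expand := by
  rw [← LinearMap.ker_eq_bot, LinearMap.ker_eq_bot']
  suffices ∀ (v : SInf) (c : SInf →₀ ℤ), expand c = 0 → c v = 0 from
    fun c hc => Finsupp.ext fun v => this v c hc
  intro v
  induction v using induction_on_descents with
  | _ v ih =>
    intro c hc
    by_cases hv : v = 1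
    · rw [hv, ← constantCoeff_expand, hc, map_zero]
    · obtain ⟨a, ha⟩ := exists_descent hv
      rw [← divDiff_apply_mulSwap ha]
      exact ih a ha (divDiff a c) (expand_divDiff_eq_of_sub_swapVar_eq
        (by rw [hc, map_zero, sub_zero, mul_zero]))

open Classical in
/-- The basis vector of `w t_{ab}` if this permutation covers `w` in the Bruhat order and `a < b`,
and `0` otherwise. -/
noncomputable def cover (w : SInf) (a b : ℕ) : SInf →₀ ℤ :=
  if w.CoveredBySwap a b then Finsupp.single (w.mulSwap a b) 1 else 0

theorem cover_of_coveredBySwap {w : SInf} {a b : ℕ} (h : w.CoveredBySwap a b) :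
    w.cover a b = Finsupp.single (w.mulSwap a b) 1 := if_pos h

theorem cover_of_not_coveredBySwap {w : SInf} {a b : ℕ} (h : ¬w.CoveredBySwap a b) :
    w.cover a b = 0 := if_neg h

theorem cover_of_le (w : SInf) {a b : ℕ} (h : b ≤ a) : w.cover a b = 0 :=
  cover_of_not_coveredBySwap fun h' => h.not_gt h'.1

theorem coveredBySwap_adjacent {w : SInf} {a : ℕ} (ha : w.1 a < w.1 (a + 1)) :
    w.CoveredBySwap a (a + 1) := ⟨a.lt_succ_self, ha, fun p _ _ => by omega⟩

theorem cover_mulSwap_adjacent {w : SInf} {a : ℕ} (ha : w.1 (a + 1) < w.1 a) :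
    (w.mulSwap a (a + 1)).cover a (a + 1) = Finsupp.single w 1 := by
  rw [cover_of_coveredBySwap (coveredBySwap_adjacent _), mulSwap_mulSwap_self]
  rwa [mulSwap_apply_left, mulSwap_apply_right]

theorem divDiff_cover_of_ascent {w : SInf} {a p q : ℕ} (ha : w.1 a < w.1 (a + 1)) :
    divDiff a (w.cover p q) = if p = a ∧ q = a + 1 then Finsupp.single w 1 else 0 := by
  by_cases hw : w.CoveredBySwap p q
  · rw [cover_of_coveredBySwap hw, divDiff_single]
    split_ifs with hdesc heq heq
    · rw [heq.1, heq.2, mulSwap_mulSwap_self]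
    · exact absurd hdesc (hw.ascent_mulSwap ha heq).asymm
    · rw [heq.1, heq.2, mulSwap_apply_left, mulSwap_apply_right] at hdesc
      exact absurd ha hdesc
    · rfl
  · rw [cover_of_not_coveredBySwap hw, map_zero, if_neg]
    rintro ⟨rfl, rfl⟩
    exact hw (coveredBySwap_adjacent ha)

theorem divDiff_cover_of_descent_of_lt {w : SInf} {a p q : ℕ} (ha : w.1 (a + 1) < w.1 a)
    (hpq : p < q) (hne : ¬(p = a ∧ q = a + 1)) :
    divDiff a (w.cover p q) =
      (w.mulSwap a (a + 1)).cover (Equiv.swap a (a + 1) p) (Equiv.swap a (a + 1) q) := by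
  have hiff := coveredBySwap_mulSwap_adjacent_iff_of_descent ha hpq hne
  by_cases h : w.CoveredBySwap p q ∧ (w.mulSwap p q).1 (a + 1) < (w.mulSwap p q).1 a
  · rw [cover_of_coveredBySwap h.1, divDiff_single, if_pos h.2,
      cover_of_coveredBySwap (hiff.2 h), mulSwap_mulSwap]
  · rw [cover_of_not_coveredBySwap (mt hiff.1 h)]
    by_cases hw : w.CoveredBySwap p q
    · rw [cover_of_coveredBySwap hw, divDiff_single, if_neg fun hdesc => h ⟨hw, hdesc⟩]
    · rw [cover_of_not_coveredBySwap hw, map_zero]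

theorem divDiff_cover_of_descent {w : SInf} {a p q : ℕ} (ha : w.1 (a + 1) < w.1 a) :
    divDiff a (w.cover p q) =
      (w.mulSwap a (a + 1)).cover (Equiv.swap a (a + 1) p) (Equiv.swap a (a + 1) q) -
        if q = a ∧ p = a + 1 then Finsupp.single w 1 else 0 := by
  rcases lt_or_ge p q with hpq | hqp
  · rw [if_neg (by omega), sub_zero]
    by_cases hne : p = a ∧ q = a + 1
    · rw [hne.1, hne.2, Equiv.swap_apply_left, Equiv.swap_apply_right,
        cover_of_le _ a.le_succ, cover_of_not_coveredBySwap fun h => ha.asymm h.2.1, map_zero]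
    · exact divDiff_cover_of_descent_of_lt ha hpq hne
  · rw [cover_of_le _ hqp, map_zero]
    split_ifs with h
    · rw [h.1, h.2, Equiv.swap_apply_left, Equiv.swap_apply_right, cover_mulSwap_adjacent ha,
        sub_self]
    · rw [sub_zero, cover_of_le]
      rcases hqp.eq_or_lt with rfl | hqp
      · rfl
      · exact (swap_adjacent_lt_swap_adjacent hqp h).le

/-- The antisymmetrization of `cover`: it carries the signs with which the covers `w t_{kb}` of `w`
occur in the expansion of `x_k 𝔖_w`. -/
noncomputable def signedCover (w : SInf) (a b : ℕ) : SInf →₀ ℤ :=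
  w.cover a b - w.cover b a

theorem divDiff_signedCover (w : SInf) (a k b : ℕ) :
    divDiff a (w.signedCover k b) =
      (if w.1 (a + 1) < w.1 a then (w.mulSwap a (a + 1)).signedCover
        (Equiv.swap a (a + 1) k) (Equiv.swap a (a + 1) b) else 0) +
      ((if k = a ∧ b = a + 1 then Finsupp.single w 1 else 0) -
        (if b = a ∧ k = a + 1 then Finsupp.single w 1 else 0)) := by
  rw [signedCover, map_sub]
  rcases w.ascent_or_descent a with ha | ha
  · rw [if_neg ha.asymm, divDiff_cover_of_ascent ha, divDiff_cover_of_ascent ha, zero_add]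
  · rw [if_pos ha, divDiff_cover_of_descent ha, divDiff_cover_of_descent ha, signedCover]
    abel

/-- The coefficients of `x_k 𝔖_w`, provided that `w` fixes the positions from `B - 1` on and
`k + 1 < B`: only the positions smaller than `B` take part. -/
noncomputable def monk (B k : ℕ) (w : SInf) : SInf →₀ ℤ := ∑ b ∈ Finset.range B, w.signedCover k b

theorem divDiff_monk {B N k a : ℕ} {w : SInf} (hw : w.FixesFrom N) (hB : N < B) (hk : k + 1 < B) :
    divDiff a (monk B k w) =
      (if w.1 (a + 1) < w.1 a then monk B (Equiv.swap a (a + 1) k) (w.mulSwap a (a + 1)) else 0) +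
      ((if k = a then Finsupp.single w 1 else 0) -
        (if k = a + 1 then Finsupp.single w 1 else 0)) := by
  simp only [monk, map_sum, divDiff_signedCover, Finset.sum_add_distrib, Finset.sum_sub_distrib]
  congr 2
  · split_ifs with ha
    · have haN := hw.lt_of_inversion a.lt_succ_self ha
      refine Finset.sum_equiv (Equiv.swap a (a + 1)) (fun b => ?_) (fun _ _ => rfl)
      simp only [Finset.mem_range, Equiv.swap_apply_def]
      split_ifs <;> omega
    · exact Finset.sum_const_zero
  · simp only [ite_and, Finset.sum_ite_irrel, Finset.sum_ite_eq', Finset.sum_const_zero,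
      Finset.mem_range]
    split_ifs <;> first | rfl | omega
  · simp only [ite_and, Finset.sum_ite_eq', Finset.mem_range]
    split_ifs <;> first | rfl | omega

theorem CoveredBySwap.mulSwap_ne_one {w : SInf} {a b : ℕ} (h : w.CoveredBySwap a b) :
    w.mulSwap a b ≠ 1 := fun heq => by
  have hlength := h.length_mulSwap
  rw [heq, length_one] at hlength
  omega

theorem cover_apply_one (w : SInf) (a b : ℕ) : w.cover a b 1 = 0 := by
  by_cases h : w.CoveredBySwap a b
  · rw [cover_of_coveredBySwap h, Finsupp.single_eq_of_ne h.mulSwap_ne_one.symm]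
  · rw [cover_of_not_coveredBySwap h, Finsupp.zero_apply]

theorem monk_apply_one (B k : ℕ) (w : SInf) : monk B k w 1 = 0 := by
  rw [monk, Finsupp.finsetSum_apply]
  refine Finset.sum_eq_zero fun b _ => ?_
  rw [signedCover, Finsupp.sub_apply, cover_apply_one, cover_apply_one, sub_zero]

theorem X_sub_X_swap (a k : ℕ) : (X k - X (Equiv.swap a (a + 1) k) : MvPolynomial ℕ ℤ) =
    (X a - X (a + 1)) * ((if k = a then 1 else 0) - (if k = a + 1 then 1 else 0)) := by
  rw [Equiv.swap_apply_def]
  split_ifs <;> first | omega | (subst_vars; ring)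

theorem X_mul_schubert {B N k : ℕ} {w : SInf} (hw : w.FixesFrom N) (hB : N < B) (hk : k + 1 < B) :
    X k * w.schubert = expand (monk B k w) := by
  induction w using induction_on_descents generalizing k with
  | _ w ih =>
    have hdivDiff (a : ℕ) : expand (divDiff a (monk B k w)) = X (Equiv.swap a (a + 1) k) *
        (if w.1 (a + 1) < w.1 a then (w.mulSwap a (a + 1)).schubert else 0) +
        ((if k = a then 1 else 0) - (if k = a + 1 then 1 else 0)) * w.schubert := by
      rw [divDiff_monk hw hB hk, map_add]
      congr 1
      · split_ifs with ha
        · have haN := hw.lt_of_inversion a.lt_succ_self ha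
          rw [ih a ha (hw.mulSwap (by omega) haN)]
          rw [Equiv.swap_apply_def]
          split_ifs <;> omega
        · rw [map_zero, mul_zero]
      · split_ifs <;> simp [expand_single]
    refine eq_of_forall_sub_swapVar_eq (fun a => ?_) ?_
    · rw [expand_sub_swapVar_expand, hdivDiff, map_mul, swapVar_X]
      linear_combination X (Equiv.swap a (a + 1) k) * w.schubert_sub_swapVar a +
        w.schubert * X_sub_X_swap a k
    · rw [map_mul, constantCoeff_X, zero_mul, constantCoeff_expand, monk_apply_one]

theorem expand_surjective : Function.Surjective expand := by
  intro f
  induction f using MvPolynomial.induction_on with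
  | C r => exact ⟨Finsupp.single 1 r, by rw [expand_single, schubert_one, smul_eq_C_mul, mul_one]⟩
  | add f g hf hg =>
    obtain ⟨c, rfl⟩ := hf
    obtain ⟨d, rfl⟩ := hg
    exact ⟨c + d, map_add _ _ _⟩
  | mul_X f k hf =>
    obtain ⟨c, rfl⟩ := hf
    induction c using Finsupp.induction_linear with
    | zero => exact ⟨0, by rw [map_zero, zero_mul]⟩
    | add c d hc hd =>
      obtain ⟨c', hc'⟩ := hc
      obtain ⟨d', hd'⟩ := hd
      exact ⟨c' + d', by rw [map_add, map_add, hc', hd', add_mul]⟩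
    | single w r =>
      obtain ⟨N, hN⟩ := w.exists_fixesFrom
      refine ⟨r • monk (N + k + 2) k w, ?_⟩
      rw [map_smul, ← X_mul_schubert hN (by omega) (by omega), expand_single, smul_mul_assoc,
        mul_comm]

/-- The linear extension of `w ↦ w.cover a b`. -/
noncomputable def coverOp (a b : ℕ) : Module.End ℤ (SInf →₀ ℤ) :=
  Finsupp.linearCombination ℤ fun w => w.cover a b

theorem coverOp_single (a b : ℕ) (w : SInf) : coverOp a b (Finsupp.single w 1) = w.cover a b := by
  rw [coverOp, Finsupp.linearCombination_single, one_smul]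

open Classical in
theorem coverOp_cover (w : SInf) (a b c d : ℕ) :
    coverOp c d (w.cover a b) =
      if w.CoveredBySwap a b ∧ (w.mulSwap a b).CoveredBySwap c d then
        Finsupp.single ((w.mulSwap a b).mulSwap c d) 1 else 0 := by
  by_cases h : w.CoveredBySwap a b
  · rw [cover_of_coveredBySwap h, coverOp_single, cover, if_congr (and_iff_right h) rfl rfl]
  · rw [cover_of_not_coveredBySwap h, map_zero, if_neg fun h' => h h'.1]

theorem coverOp_cover_eq_zero {w : SInf} {a b c d : ℕ}
    (h : (w.mulSwap a b).1 d ≤ (w.mulSwap a b).1 c) : coverOp c d (w.cover a b) = 0 := by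
  rw [coverOp_cover, if_neg fun h' => h.not_gt h'.2.2.1]

open Classical in
theorem coverOp_cover_comm (w : SInf) {a b c d : ℕ} (hac : a ≠ c) (had : a ≠ d) (hbc : b ≠ c)
    (hbd : b ≠ d) : coverOp c d (w.cover a b) = coverOp a b (w.cover c d) := by
  rw [coverOp_cover, coverOp_cover, mulSwap_comm w hac had hbc hbd]
  exact if_congr ⟨fun h => h.1.comm hac had hbc hbd h.2,
    fun h => h.1.comm hac.symm hbc.symm had.symm hbd.symm h.2⟩ rfl rfl

open Classical in
theorem coverOp_chain_of_lt {w : SInf} {a m b : ℕ} (ham : a < m) (hmb : m < b)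
    (h : w.1 a < w.1 m) : coverOp a m (w.cover m b) = coverOp a b (w.cover a m) := by
  rw [coverOp_cover, coverOp_cover, mulSwap_mulSwap w a m m b, Equiv.swap_apply_right,
    Equiv.swap_apply_of_ne_of_ne (by omega) (by omega)]
  exact if_congr (coveredBySwap_chain_iff_of_lt ham hmb h) rfl rfl

open Classical in
theorem coverOp_chain_of_gt {w : SInf} {a m b : ℕ} (ham : a < m) (hmb : m < b)
    (h : w.1 m < w.1 a) : coverOp a m (w.cover m b) = coverOp m b (w.cover a b) := by
  rw [coverOp_cover, coverOp_cover, mulSwap_mulSwap w m b a b, Equiv.swap_apply_right,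
    Equiv.swap_apply_of_ne_of_ne (by omega) (by omega)]
  exact if_congr (coveredBySwap_chain_iff_of_gt ham hmb h) rfl rfl

/-- The sum of the covers of `w` that exchange the value `c`, at a position smaller than `m`, with a
larger value at a position `b` with `m ≤ b < B`. -/
noncomputable def valueCovers (B m c : ℕ) (w : SInf) : SInf →₀ ℤ :=
  if w.1.symm c < m then ∑ b ∈ Finset.Ico m B, w.cover (w.1.symm c) b else 0

/-- The part of the expansion of `x_m 𝔖_w` that consists of the terms exchanging two values the
smaller of which is less than `c`. -/
noncomputable def monkBelow (B m c : ℕ) (w : SInf) : SInf →₀ ℤ :=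
  (if w.1 m < c then ∑ b ∈ Finset.Ico (m + 1) B, w.cover m b else 0) -
    ∑ a ∈ Finset.range m, if w.1 a < c then w.cover a m else 0

/-- The linear extension of `valueCovers`. -/
noncomputable def valueOp (B m c : ℕ) : Module.End ℤ (SInf →₀ ℤ) :=
  Finsupp.linearCombination ℤ (valueCovers B m c)

/-- The linear extension of `monkBelow`. -/
noncomputable def monkOp (B m c : ℕ) : Module.End ℤ (SInf →₀ ℤ) :=
  Finsupp.linearCombination ℤ (monkBelow B m c)

theorem valueOp_single (B m c : ℕ) (w : SInf) :
    valueOp B m c (Finsupp.single w 1) = valueCovers B m c w := by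
  rw [valueOp, Finsupp.linearCombination_single, one_smul]

theorem monkOp_single (B m c : ℕ) (w : SInf) :
    monkOp B m c (Finsupp.single w 1) = monkBelow B m c w := by
  rw [monkOp, Finsupp.linearCombination_single, one_smul]

theorem valueCovers_apply (B m p : ℕ) (w : SInf) :
    valueCovers B m (w.1 p) w = if p < m then ∑ b ∈ Finset.Ico m B, w.cover p b else 0 := by
  rw [valueCovers, Equiv.symm_apply_apply]

theorem valueOp_cover (B m p x y : ℕ) (w : SInf) :
    valueOp B m (w.1 p) (w.cover x y) = if Equiv.swap x y p < m then
      ∑ b ∈ Finset.Ico m B, coverOp (Equiv.swap x y p) b (w.cover x y) else 0 := by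
  by_cases h : w.CoveredBySwap x y
  · have hp : w.1 p = (w.mulSwap x y).1 (Equiv.swap x y p) := by
      rw [mulSwap_apply, Equiv.swap_apply_self]
    simp only [cover_of_coveredBySwap h, coverOp_single, valueOp_single, hp, valueCovers_apply]
  · simp only [cover_of_not_coveredBySwap h, map_zero, Finset.sum_const_zero, ite_self]

theorem monkOp_cover (B m c x y : ℕ) (w : SInf) :
    monkOp B m c (w.cover x y) =
      (if (w.mulSwap x y).1 m < c then
        ∑ b ∈ Finset.Ico (m + 1) B, coverOp m b (w.cover x y) else 0) -
      ∑ a ∈ Finset.range m,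
        if (w.mulSwap x y).1 a < c then coverOp a m (w.cover x y) else 0 := by
  by_cases h : w.CoveredBySwap x y
  · simp only [cover_of_coveredBySwap h, coverOp_single, monkOp_single, monkBelow]
  · simp only [cover_of_not_coveredBySwap h, map_zero, Finset.sum_const_zero, ite_self, sub_zero]

theorem monkBelow_succ (B m p : ℕ) (w : SInf) :
    monkBelow B m (w.1 p + 1) w = monkBelow B m (w.1 p) w +
      (if p = m then ∑ b ∈ Finset.Ico (m + 1) B, w.cover m b else 0) -
        if p < m then w.cover p m else 0 := by
  have hsplit (a : ℕ) (z : SInf →₀ ℤ) : (if w.1 a < w.1 p + 1 then z else 0) =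
      (if w.1 a < w.1 p then z else 0) + if a = p then z else 0 := by
    have hap : a = p ↔ w.1 a = w.1 p := w.1.injective.eq_iff.symm
    simp only [hap]
    split_ifs <;> first | omega | simp only [add_zero, zero_add]
  simp only [monkBelow, hsplit, Finset.sum_add_distrib, Finset.sum_ite_eq', Finset.mem_range,
    eq_comm (a := m)]
  abel

theorem monkBelow_add_valueCovers {B m c : ℕ} (hB : m < B) (w : SInf) :
    monkBelow B m c w + valueCovers B (m + 1) c w =
      monkBelow B m (c + 1) w + valueCovers B m c w := by
  obtain ⟨p, rfl⟩ := w.1.surjective c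
  rw [monkBelow_succ, valueCovers_apply, valueCovers_apply]
  rcases lt_trichotomy p m with h | rfl | h
  · rw [if_pos (by omega), if_neg h.ne, if_pos h, if_pos h,
      Finset.sum_eq_sum_Ico_succ_bot hB]
    abel
  · rw [if_pos (by omega), if_pos rfl, if_neg (lt_irrefl _), if_neg (lt_irrefl _)]
    abel
  · rw [if_neg (by omega), if_neg h.ne', if_neg h.asymm, if_neg h.asymm]
    abel

theorem monkOp_cover_self {B m b : ℕ} (w : SInf) (hmb : m < b) :
    monkOp B m (w.1 m) (w.cover m b) =
      -∑ a ∈ Finset.range m, if w.1 a < w.1 m then coverOp a b (w.cover a m) else 0 := by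
  by_cases hcov : w.CoveredBySwap m b
  · rw [monkOp_cover, mulSwap_apply_left, if_neg hcov.2.1.asymm, zero_sub, neg_inj]
    refine Finset.sum_congr rfl fun a ha => ?_
    rw [Finset.mem_range] at ha
    rw [mulSwap_apply_of_ne _ (by omega) (by omega)]
    split_ifs with hlt
    · exact coverOp_chain_of_lt ha hmb hlt
    · rfl
  · rw [cover_of_not_coveredBySwap hcov, map_zero, eq_comm, neg_eq_zero]
    refine Finset.sum_eq_zero fun a ha => ?_
    split_ifs with hlt
    · rw [← coverOp_chain_of_lt (Finset.mem_range.1 ha) hmb hlt,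
        cover_of_not_coveredBySwap hcov, map_zero]
    · rfl

theorem valueOp_cover_left {B m a : ℕ} (hB : m < B) (w : SInf) (ha : a < m)
    (hlt : w.1 a < w.1 m) :
    valueOp B m (w.1 m) (w.cover a m) =
      ∑ b ∈ Finset.Ico (m + 1) B, coverOp a b (w.cover a m) := by
  rw [valueOp_cover, Equiv.swap_apply_right, if_pos ha, Finset.sum_eq_sum_Ico_succ_bot hB,
    coverOp_cover_eq_zero, zero_add]
  rw [mulSwap_apply_left, mulSwap_apply_right]
  exact hlt.le

theorem monkOp_valueCovers_self {B m : ℕ} (hB : m < B) (w : SInf) :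
    monkOp B m (w.1 m) (valueCovers B (m + 1) (w.1 m) w) =
      valueOp B m (w.1 m) (monkBelow B m (w.1 m + 1) w) := by
  have hvanish : ∀ b ∈ Finset.Ico (m + 1) B, valueOp B m (w.1 m) (w.cover m b) = 0 := by
    intro b hb
    rw [Finset.mem_Ico] at hb
    rw [valueOp_cover, Equiv.swap_apply_left, if_neg (by omega)]
  have hleft : ∀ b ∈ Finset.Ico (m + 1) B, monkOp B m (w.1 m) (w.cover m b) =
      -∑ a ∈ Finset.range m, if w.1 a < w.1 m then coverOp a b (w.cover a m) else 0 :=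
    fun b hb => monkOp_cover_self w (Finset.mem_Ico.1 hb).1
  have hright : ∀ a ∈ Finset.range m,
      valueOp B m (w.1 m) (if w.1 a < w.1 m then w.cover a m else 0) =
        ∑ b ∈ Finset.Ico (m + 1) B, if w.1 a < w.1 m then coverOp a b (w.cover a m) else 0 := by
    intro a ha
    split_ifs with hlt
    · exact valueOp_cover_left hB w (Finset.mem_range.1 ha) hlt
    · rw [map_zero, Finset.sum_const_zero]
  rw [valueCovers_apply, if_pos m.lt_succ_self, monkBelow_succ, if_pos rfl, if_neg (lt_irrefl m),
    sub_zero, monkBelow, if_neg (lt_irrefl _), zero_sub, map_add, map_neg, map_sum, map_sum,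
    map_sum, Finset.sum_eq_zero hvanish, add_zero, Finset.sum_congr rfl hleft,
    Finset.sum_congr rfl hright, Finset.sum_neg_distrib, Finset.sum_comm]

theorem monkOp_cover_of_lt {B m p b : ℕ} (w : SInf) (hpm : p < m) (hmb : m < b) :
    monkOp B m (w.1 p) (w.cover p b) =
      (if w.1 m < w.1 p then ∑ b' ∈ Finset.Ico (m + 1) B, coverOp m b' (w.cover p b) else 0) -
        ∑ a ∈ Finset.range m, if w.1 a < w.1 p then coverOp p b (w.cover a m) else 0 := by
  rw [monkOp_cover, mulSwap_apply_of_ne _ (by omega) (by omega)]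
  congr 1
  refine Finset.sum_congr rfl fun a ha => ?_
  rw [Finset.mem_range] at ha
  rcases eq_or_ne a p with rfl | hap
  · rw [if_neg (lt_irrefl _)]
    by_cases hcov : w.CoveredBySwap a b
    · rw [mulSwap_apply_left, if_neg hcov.2.1.asymm]
    · rw [cover_of_not_coveredBySwap hcov, map_zero, ite_self]
  · rw [mulSwap_apply_of_ne _ hap (by omega),
      coverOp_cover_comm w hap.symm (by omega) (by omega) (by omega)]

theorem valueOp_cover_of_gt {B m p b' : ℕ} (w : SInf) (hpm : p < m)
    (hb' : b' ∈ Finset.Ico (m + 1) B) (hlt : w.1 m < w.1 p) :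
    valueOp B m (w.1 p) (w.cover m b') =
      ∑ b ∈ Finset.Ico (m + 1) B, coverOp m b' (w.cover p b) := by
  have hmb := Finset.mem_Ico.1 hb'
  have hvanish : coverOp p b' (w.cover m b') = 0 := coverOp_cover_eq_zero <| by
    rw [mulSwap_apply_right, mulSwap_apply_of_ne _ (by omega) (by omega)]
    exact hlt.le
  rw [valueOp_cover, Equiv.swap_apply_of_ne_of_ne (by omega) (by omega), if_pos hpm,
    Finset.sum_eq_sum_Ico_succ_bot (by omega), coverOp_chain_of_gt hpm (by omega) hlt,
    ← Finset.add_sum_erase _ _ hb', ← Finset.add_sum_erase _ _ hb', hvanish, zero_add]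
  congr 1
  refine Finset.sum_congr rfl fun b hb => ?_
  rw [Finset.mem_erase, Finset.mem_Ico] at hb
  exact coverOp_cover_comm w (by omega) (by omega) (by omega) hb.1.symm

theorem valueOp_cover_of_lt {B m p a : ℕ} (hB : m < B) (w : SInf) (hpm : p < m)
    (hlt : w.1 a < w.1 p) :
    valueOp B m (w.1 p) (w.cover a m) =
      ∑ b ∈ Finset.Ico (m + 1) B, coverOp p b (w.cover a m) := by
  have hpa : p ≠ a := fun h => hlt.ne (by rw [h])
  rw [valueOp_cover, Equiv.swap_apply_of_ne_of_ne hpa hpm.ne, if_pos hpm,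
    Finset.sum_eq_sum_Ico_succ_bot hB, coverOp_cover_eq_zero, zero_add]
  rw [mulSwap_apply_right, mulSwap_apply_of_ne _ hpa hpm.ne]
  exact hlt.le

theorem monkOp_valueCovers_of_lt {B m p : ℕ} (hB : m < B) (w : SInf) (hpm : p < m) :
    monkOp B m (w.1 p) (valueCovers B (m + 1) (w.1 p) w) =
      valueOp B m (w.1 p) (monkBelow B m (w.1 p + 1) w) := by
  have hvanish : valueOp B m (w.1 p) (w.cover p m) = 0 := by
    rw [valueOp_cover, Equiv.swap_apply_left, if_neg (lt_irrefl m)]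
  have hleft : ∀ b ∈ Finset.Ico (m + 1) B, monkOp B m (w.1 p) (w.cover p b) = _ :=
    fun b hb => monkOp_cover_of_lt w hpm (Finset.mem_Ico.1 hb).1
  have hright_pos : valueOp B m (w.1 p)
      (if w.1 m < w.1 p then ∑ b ∈ Finset.Ico (m + 1) B, w.cover m b else 0) =
        ∑ b ∈ Finset.Ico (m + 1) B, if w.1 m < w.1 p then
          ∑ b' ∈ Finset.Ico (m + 1) B, coverOp m b' (w.cover p b) else 0 := by
    split_ifs with hlt
    · rw [map_sum, Finset.sum_comm]
      exact Finset.sum_congr rfl fun b' hb' => valueOp_cover_of_gt w hpm hb' hlt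
    · rw [map_zero, Finset.sum_const_zero]
  have hright_neg : ∀ a ∈ Finset.range m,
      valueOp B m (w.1 p) (if w.1 a < w.1 p then w.cover a m else 0) =
        ∑ b ∈ Finset.Ico (m + 1) B, if w.1 a < w.1 p then coverOp p b (w.cover a m) else 0 := by
    intro a _
    split_ifs with hlt
    · exact valueOp_cover_of_lt hB w hpm hlt
    · rw [map_zero, Finset.sum_const_zero]
  rw [valueCovers_apply, if_pos (by omega), monkBelow_succ, if_neg hpm.ne, if_pos hpm, add_zero,
    map_sub, hvanish, sub_zero, monkBelow, map_sub, map_sum, map_sum, hright_pos,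
    Finset.sum_congr rfl hright_neg, Finset.sum_congr rfl hleft, Finset.sum_sub_distrib,
    Finset.sum_comm (s := Finset.range m)]

theorem monkOp_valueCovers_of_gt {B m p : ℕ} (w : SInf) (hmp : m < p) :
    monkOp B m (w.1 p) (valueCovers B (m + 1) (w.1 p) w) =
      valueOp B m (w.1 p) (monkBelow B m (w.1 p + 1) w) := by
  have hpos : ∀ b ∈ Finset.Ico (m + 1) B, valueOp B m (w.1 p) (w.cover m b) = 0 := by
    intro b hb
    rw [Finset.mem_Ico] at hb
    rw [valueOp_cover, if_neg]
    rw [Equiv.swap_apply_def]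
    split_ifs <;> omega
  have hneg : ∀ a ∈ Finset.range m,
      valueOp B m (w.1 p) (if w.1 a < w.1 p then w.cover a m else 0) = 0 := by
    intro a ha
    rw [Finset.mem_range] at ha
    split_ifs
    · rw [valueOp_cover, Equiv.swap_apply_of_ne_of_ne (by omega) (by omega), if_neg hmp.asymm]
    · rw [map_zero]
  rw [valueCovers_apply, if_neg (by omega), map_zero, monkBelow_succ, if_neg hmp.ne',
    if_neg hmp.asymm, add_zero, sub_zero, monkBelow, map_sub, map_sum, Finset.sum_eq_zero hneg,
    sub_zero]
  split_ifs
  · rw [map_sum, Finset.sum_eq_zero hpos]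
  · rw [map_zero]

theorem monkOp_valueCovers {B m : ℕ} (hB : m < B) (c : ℕ) (w : SInf) :
    monkOp B m c (valueCovers B (m + 1) c w) = valueOp B m c (monkBelow B m (c + 1) w) := by
  obtain ⟨p, rfl⟩ := w.1.surjective c
  rcases lt_trichotomy p m with hpm | rfl | hmp
  · exact monkOp_valueCovers_of_lt hB w hpm
  · exact monkOp_valueCovers_self hB w
  · exact monkOp_valueCovers_of_gt w hmp

theorem one_add_monkOp_mul {B m : ℕ} (hB : m < B) (c : ℕ) :
    (1 + monkOp B m c) * (1 + valueOp B (m + 1) c) =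
      (1 + valueOp B m c) * (1 + monkOp B m (c + 1)) := by
  have hadd : monkOp B m c + valueOp B (m + 1) c = monkOp B m (c + 1) + valueOp B m c := by
    refine Finsupp.lhom_ext' fun w => LinearMap.ext_ring ?_
    simp only [LinearMap.comp_apply, Finsupp.lsingle_apply, LinearMap.add_apply, valueOp_single,
      monkOp_single, monkBelow_add_valueCovers hB]
  have hmul : monkOp B m c * valueOp B (m + 1) c = valueOp B m c * monkOp B m (c + 1) := by
    refine Finsupp.lhom_ext' fun w => LinearMap.ext_ring ?_
    simp only [LinearMap.comp_apply, Finsupp.lsingle_apply, Module.End.mul_apply, valueOp_single,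
      monkOp_single, monkOp_valueCovers hB]
  simp only [mul_add, add_mul, one_mul, mul_one, hmul]
  rw [eq_sub_of_add_eq hadd]
  abel

/-- The product of the operators `1 + valueOp B m d` for `d < c`, larger values acting first. -/
noncomputable def pieriOp (B m : ℕ) : ℕ → Module.End ℤ (SInf →₀ ℤ)
  | 0 => 1
  | c + 1 => pieriOp B m c * (1 + valueOp B m c)

theorem monkOp_zero (B m : ℕ) : monkOp B m 0 = 0 := by
  refine Finsupp.lhom_ext' fun w => LinearMap.ext_ring ?_
  simp [monkOp, monkBelow]

theorem valueOp_zero (B c : ℕ) : valueOp B 0 c = 0 := by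
  refine Finsupp.lhom_ext' fun w => LinearMap.ext_ring ?_
  simp [valueOp, valueCovers]

theorem pieriOp_succ {B m : ℕ} (hB : m < B) (c : ℕ) :
    pieriOp B (m + 1) c = pieriOp B m c * (1 + monkOp B m c) := by
  induction c with
  | zero => rw [monkOp_zero, add_zero, mul_one, pieriOp, pieriOp]
  | succ c ih => rw [pieriOp, pieriOp, ih, mul_assoc, one_add_monkOp_mul hB, ← mul_assoc]

theorem pieriOp_zero (B c : ℕ) : pieriOp B 0 c = 1 := by
  induction c with
  | zero => rfl
  | succ c ih => rw [pieriOp, ih, valueOp_zero, add_zero, mul_one]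

theorem sum_cover_eq_sum_Ico (B m : ℕ) (w : SInf) :
    ∑ b ∈ Finset.range B, w.cover m b = ∑ b ∈ Finset.Ico (m + 1) B, w.cover m b := by
  refine (Finset.sum_subset (fun b hb => ?_) fun b hb hb' => cover_of_le _ ?_).symm
  · exact Finset.mem_range.2 (Finset.mem_Ico.1 hb).2
  · rw [Finset.mem_range] at hb
    rw [Finset.mem_Ico] at hb'
    omega

theorem sum_cover_eq_sum_range {B m : ℕ} (hB : m ≤ B) (w : SInf) :
    ∑ b ∈ Finset.range B, w.cover b m = ∑ a ∈ Finset.range m, w.cover a m := by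
  refine (Finset.sum_subset (Finset.range_mono hB) fun b _ hb => cover_of_le _ ?_).symm
  exact not_lt.1 (mt Finset.mem_range.2 hb)

theorem monkBelow_eq_monk {B N m : ℕ} {w : SInf} (hw : w.FixesFrom N) (hm : m < N) (hB : N ≤ B) :
    monkBelow B m B w = monk B m w := by
  have hlt {a : ℕ} (ha : a < N) : w.1 a < B := (hw.apply_lt ha).trans_le hB
  simp only [monk, signedCover, Finset.sum_sub_distrib]
  rw [monkBelow, if_pos (hlt hm), sum_cover_eq_sum_Ico, sum_cover_eq_sum_range (by omega)]
  congr 1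
  exact Finset.sum_congr rfl fun a ha => if_pos (hlt ((Finset.mem_range.1 ha).trans hm))

theorem CoveredBySwap.le_of_fixesFrom {N a b : ℕ} {w : SInf} (h : w.CoveredBySwap a b)
    (hw : w.FixesFrom N) (ha : a < N) : b ≤ N := by
  by_contra! hb
  have hbetween := h.2.2 N ha hb
  rw [hw N le_rfl, hw b hb.le] at hbetween
  have haN := hw.apply_lt ha
  omega

theorem fixesFrom_of_mem_support_cover {N a b : ℕ} {v w : SInf} (hw : w.FixesFrom N) (ha : a < N)
    (hv : v ∈ (w.cover a b).support) : v.FixesFrom (N + 1) := by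
  by_cases h : w.CoveredBySwap a b
  · rw [cover_of_coveredBySwap h] at hv
    rw [Finset.mem_singleton.1 (Finsupp.support_single_subset hv)]
    have hb := h.le_of_fixesFrom hw ha
    exact (hw.mono N.le_succ).mulSwap (by omega) (by omega)
  · rw [cover_of_not_coveredBySwap h] at hv
    exact absurd hv (Finset.notMem_empty v)

theorem fixesFrom_of_mem_support_monk {B N k : ℕ} {v w : SInf} (hw : w.FixesFrom N) (hk : k < N)
    (hv : v ∈ (monk B k w).support) : v.FixesFrom (N + 1) := by
  classical
  obtain ⟨b, -, hb⟩ := Finset.mem_biUnion.1 (Finsupp.support_finsetSum hv)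
  rcases Finset.mem_union.1 (Finsupp.support_sub hb) with h | h
  · exact fixesFrom_of_mem_support_cover hw hk h
  · rcases le_or_gt k b with hkb | hbk
    · rw [cover_of_le _ hkb] at h
      exact absurd h (Finset.notMem_empty v)
    · exact fixesFrom_of_mem_support_cover hw (hbk.trans hk) h

theorem mul_expand_eq_expand_of_forall_mem_support {f : MvPolynomial ℕ ℤ}
    {L : Module.End ℤ (SInf →₀ ℤ)} {c : SInf →₀ ℤ}
    (h : ∀ v ∈ c.support, f * v.schubert = expand (L (Finsupp.single v 1))) :
    f * expand c = expand (L c) := by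
  have hsum : c = ∑ v ∈ c.support, c v • Finsupp.single v 1 := by
    simp only [Finsupp.smul_single_one]
    exact (Finsupp.sum_single c).symm
  rw [hsum]
  simp only [map_sum, map_smul, Finset.mul_sum, mul_smul_comm, expand_single, one_smul]
  exact Finset.sum_congr rfl fun v hv => by rw [h v hv]

theorem prod_one_add_X_mul_schubert {B N m : ℕ} {w : SInf} (hw : w.FixesFrom N) (hm : m ≤ N)
    (hB : N + m < B) :
    (∏ k ∈ Finset.range m, (1 + X k)) * w.schubert =
      expand (pieriOp B m B (Finsupp.single w 1)) := by
  induction m generalizing N w with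
  | zero =>
    rw [pieriOp_zero, Finset.prod_range_zero, Module.End.one_apply, expand_single, one_smul,
      one_mul]
  | succ m ih =>
    have hmonk : (∏ k ∈ Finset.range m, (1 + X k)) * expand (monk B m w) =
        expand (pieriOp B m B (monk B m w)) :=
      mul_expand_eq_expand_of_forall_mem_support fun v hv =>
        ih (fixesFrom_of_mem_support_monk hw (by omega) hv) (by omega) (by omega)
    rw [pieriOp_succ (by omega), Module.End.mul_apply, LinearMap.add_apply, Module.End.one_apply,
      monkOp_single, monkBelow_eq_monk hw (by omega) (by omega), map_add, map_add, ← hmonk,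
      ← X_mul_schubert hw (by omega) (by omega), ← ih hw (by omega) (by omega),
      Finset.prod_range_succ]
    ring

theorem elemSym_zero_left (m : ℕ) : elemSym 0 m = 1 := by
  rw [elemSym, Finset.powersetCard_zero, Finset.sum_singleton, Finset.prod_empty]

theorem elemSym_of_lt {i m : ℕ} (h : m < i) : elemSym i m = 0 := by
  rw [elemSym, Finset.powersetCard_eq_empty.2 (by rwa [Finset.card_range]), Finset.sum_empty]

theorem elemSym_succ (i m : ℕ) :
    elemSym (i + 1) (m + 1) = elemSym (i + 1) m + X m * elemSym i m := by
  have hm {j : ℕ} {t : Finset ℕ} (ht : t ∈ (Finset.range m).powersetCard j) : m ∉ t := fun h =>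
    Finset.notMem_range_self ((Finset.mem_powersetCard.1 ht).1 h)
  rw [elemSym, Finset.range_add_one, Finset.powersetCard_succ_insert Finset.notMem_range_self,
    Finset.sum_union, Finset.sum_image, elemSym, elemSym, Finset.mul_sum]
  · congr 1
    exact Finset.sum_congr rfl fun t ht => Finset.prod_insert (hm ht)
  · intro s hs t ht hst
    rw [← Finset.erase_insert (hm hs), hst, Finset.erase_insert (hm ht)]
  · refine Finset.disjoint_left.2 fun t ht ht' => ?_
    obtain ⟨s, -, rfl⟩ := Finset.mem_image.1 ht'
    exact hm ht (Finset.mem_insert_self m s)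

theorem isHomogeneous_elemSym (i m : ℕ) : (elemSym i m).IsHomogeneous i := by
  refine IsHomogeneous.sum _ _ _ fun t ht => ?_
  have hprod := IsHomogeneous.prod t _ (fun _ => 1) fun p _ => isHomogeneous_X ℤ p
  rwa [Finset.sum_const, smul_eq_mul, mul_one, (Finset.mem_powersetCard.1 ht).2] at hprod

theorem prod_one_add_X (m : ℕ) :
    ∏ k ∈ Finset.range m, (1 + X k : MvPolynomial ℕ ℤ) =
      ∑ i ∈ Finset.range (m + 1), elemSym i m := by
  rw [Finset.prod_one_add, Finset.sum_powerset, Finset.card_range]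
  rfl

/-- The Schubert polynomials form a basis of the polynomial ring: `expand` as a linear
equivalence. -/
noncomputable def expandEquiv : (SInf →₀ ℤ) ≃ₗ[ℤ] MvPolynomial ℕ ℤ :=
  LinearEquiv.ofBijective expand ⟨expand_injective, expand_surjective⟩

/-- The coefficients of the expansion of a polynomial into Schubert polynomials. -/
noncomputable def coords : MvPolynomial ℕ ℤ →ₗ[ℤ] (SInf →₀ ℤ) := expandEquiv.symm

theorem expand_coords (f : MvPolynomial ℕ ℤ) : expand (coords f) = f :=
  expandEquiv.apply_symm_apply f

theorem coords_expand (c : SInf →₀ ℤ) : coords (expand c) = c :=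
  expandEquiv.symm_apply_apply c

theorem coords_schubert (w : SInf) : coords w.schubert = Finsupp.single w 1 := by
  rw [← coords_expand (Finsupp.single w 1), expand_single, one_smul]

theorem coords_map_apply (L : MvPolynomial ℕ ℤ →ₗ[ℤ] MvPolynomial ℕ ℤ) (f : MvPolynomial ℕ ℤ)
    (v : SInf) :
    coords (L f) v = ∑ z ∈ (coords f).support, coords f z * coords (L z.schubert) v := by
  conv_lhs => rw [← expand_coords f, expand, Finsupp.linearCombination_apply, Finsupp.sum]
  simp only [map_sum, map_smul, Finsupp.finsetSum_apply, Finsupp.smul_apply, smul_eq_mul]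

theorem coords_homogeneousComponent_apply (n : ℕ) (f : MvPolynomial ℕ ℤ) (v : SInf) :
    coords (homogeneousComponent n f) v = if v.length = n then coords f v else 0 := by
  obtain ⟨c, rfl⟩ := expand_surjective f
  induction c using Finsupp.induction_linear with
  | zero => simp only [map_zero, Finsupp.coe_zero, Pi.zero_apply, ite_self]
  | add c d hc hd =>
    simp only [map_add, Finsupp.add_apply, hc, hd]
    split_ifs <;> rfl
  | single w r =>
    rw [expand_single, map_smul, homogeneousComponent_of_mem w.isHomogeneous_schubert]
    obtain rfl | hwv := eq_or_ne w v
    · rw [eq_comm, map_smul, map_smul, apply_ite coords, map_zero]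
      split_ifs <;> simp_all
    · have hsingle : coords w.schubert v = 0 := by
        rw [coords_schubert, Finsupp.single_eq_of_ne hwv.symm]
      simp only [map_smul, Finsupp.smul_apply, apply_ite coords, map_zero, smul_eq_mul,
        apply_ite (fun z : SInf →₀ ℤ => z v), hsingle, Finsupp.coe_zero, Pi.zero_apply, ite_self,
        mul_zero]

theorem coords_elemSym_mul_schubert (i m : ℕ) (u v : SInf) :
    coords (elemSym i m * u.schubert) v = if v.length = i + u.length then
      coords ((∏ k ∈ Finset.range m, (1 + X k)) * u.schubert) v else 0 := by
  rw [← coords_homogeneousComponent_apply, prod_one_add_X, Finset.sum_mul, map_sum]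
  have hcomponent (i' : ℕ) : homogeneousComponent (i + u.length) (elemSym i' m * u.schubert) =
      if i = i' then elemSym i' m * u.schubert else 0 := by
    rw [homogeneousComponent_of_mem ((isHomogeneous_elemSym i' m).mul u.isHomogeneous_schubert)]
    simp only [Nat.add_right_cancel_iff]
  simp only [hcomponent, Finset.sum_ite_eq]
  split_ifs with hi
  · rfl
  · rw [elemSym_of_lt (by rw [Finset.mem_range] at hi; omega), zero_mul]

theorem cover_nonneg (w : SInf) (a b : ℕ) : 0 ≤ w.cover a b := by
  by_cases h : w.CoveredBySwap a b
  · rw [cover_of_coveredBySwap h]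
    exact Finsupp.single_nonneg.2 zero_le_one
  · rw [cover_of_not_coveredBySwap h]

theorem valueCovers_nonneg (B m c : ℕ) (w : SInf) : 0 ≤ valueCovers B m c w := by
  unfold valueCovers
  split_ifs
  · exact Finset.sum_nonneg fun b _ => cover_nonneg _ _ _
  · exact le_rfl

theorem valueOp_nonneg (B m c : ℕ) {z : SInf →₀ ℤ} (hz : 0 ≤ z) : 0 ≤ valueOp B m c z := by
  rw [valueOp, Finsupp.linearCombination_apply, Finsupp.sum]
  exact Finset.sum_nonneg fun w _ => smul_nonneg (hz w) (valueCovers_nonneg B m c w)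

theorem pieriOp_nonneg (B m c : ℕ) {z : SInf →₀ ℤ} (hz : 0 ≤ z) : 0 ≤ pieriOp B m c z := by
  induction c generalizing z with
  | zero => exact hz
  | succ c ih =>
    rw [pieriOp, Module.End.mul_apply]
    exact ih (add_nonneg hz (valueOp_nonneg B m c hz))

theorem exists_coveredBySwap_of_valueCovers_ne_zero {B m c : ℕ} {y v : SInf}
    (hv : valueCovers B m c y v ≠ 0) :
    ∃ b, m ≤ b ∧ y.CoveredBySwap (y.1.symm c) b ∧ v = y.mulSwap (y.1.symm c) b := by
  unfold valueCovers at hv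
  split_ifs at hv
  · rw [Finsupp.finsetSum_apply] at hv
    obtain ⟨b, hb, hcover⟩ := Finset.exists_ne_zero_of_sum_ne_zero hv
    by_cases hyb : y.CoveredBySwap (y.1.symm c) b
    · rw [cover_of_coveredBySwap hyb, Finsupp.single_apply_ne_zero] at hcover
      exact ⟨b, (Finset.mem_Ico.1 hb).1, hyb, hcover.1⟩
    · rw [cover_of_not_coveredBySwap hyb] at hcover
      exact absurd rfl hcover
  · exact absurd rfl hv

theorem exists_coveredBySwap_of_valueOp_ne_zero {B m c : ℕ} {z : SInf →₀ ℤ} {v : SInf}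
    (hv : valueOp B m c z v ≠ 0) :
    ∃ y b, z y ≠ 0 ∧ m ≤ b ∧ y.CoveredBySwap (y.1.symm c) b ∧ v = y.mulSwap (y.1.symm c) b := by
  rw [valueOp, Finsupp.linearCombination_apply, Finsupp.sum, Finsupp.finsetSum_apply] at hv
  obtain ⟨y, hy, hyv⟩ := Finset.exists_ne_zero_of_sum_ne_zero hv
  obtain ⟨b, hb⟩ := exists_coveredBySwap_of_valueCovers_ne_zero (right_ne_zero_of_mul hyv)
  exact ⟨y, b, Finsupp.mem_support_iff.1 hy, hb⟩

theorem apply_zero_of_valueOp_succ_ne_zero {B m c : ℕ} {z : SInf →₀ ℤ}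
    (hz : ∀ y, z y ≠ 0 → y.1 0 = 0) {v : SInf} (hv : valueOp B m (c + 1) z v ≠ 0) :
    v.1 0 = 0 := by
  obtain ⟨y, b, hy, -, hyb, rfl⟩ := exists_coveredBySwap_of_valueOp_ne_zero hv
  have hpos : 0 ≠ y.1.symm (c + 1) := by
    rw [Ne, Equiv.eq_symm_apply, hz y hy]
    omega
  rw [mulSwap_apply_of_ne _ hpos (by have := hyb.1; omega), hz y hy]

theorem exists_pieriOp_succ_eq_add_valueOp_zero {B m : ℕ} (c : ℕ) {z : SInf →₀ ℤ} (hz : 0 ≤ z)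
    (hz0 : ∀ y, z y ≠ 0 → y.1 0 = 0) :
    ∃ z' : SInf →₀ ℤ, 0 ≤ z' ∧ (∀ y, z' y ≠ 0 → y.1 0 = 0) ∧
      pieriOp B m (c + 1) z = z' + valueOp B m 0 z' := by
  induction c generalizing z with
  | zero => exact ⟨z, hz, hz0, rfl⟩
  | succ c ih =>
    rw [pieriOp, Module.End.mul_apply]
    refine ih (add_nonneg hz (valueOp_nonneg B m (c + 1) hz)) fun y hy => ?_
    by_cases hzy : z y = 0
    · refine apply_zero_of_valueOp_succ_ne_zero (B := B) (m := m) (c := c) hz0 fun hvalue => hy ?_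
      rw [LinearMap.add_apply, Finsupp.add_apply, Module.End.one_apply, hzy, hvalue, add_zero]
    · exact hz0 y hzy

theorem exists_coveredBySwap_of_pieriOp_ne_zero {B m c : ℕ} {z : SInf →₀ ℤ} (hz : 0 ≤ z)
    (hz0 : ∀ y, z y ≠ 0 → y.1 0 = 0) {v : SInf} (hv : pieriOp B m (c + 1) z v ≠ 0)
    (hv0 : v.1 0 ≠ 0) :
    ∃ y b, pieriOp B m (c + 1) z y ≠ 0 ∧ y.1 0 = 0 ∧ m ≤ b ∧ y.CoveredBySwap 0 b ∧
      v = y.mulSwap 0 b := by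
  obtain ⟨z', hz', hz0', heq⟩ := exists_pieriOp_succ_eq_add_valueOp_zero (B := B) (m := m) c hz hz0
  have hv' : valueOp B m 0 z' v ≠ 0 := by
    rwa [heq, Finsupp.add_apply, not_not.1 (mt (hz0' v) hv0), zero_add] at hv
  obtain ⟨y, b, hy, hb, hyb, rfl⟩ := exists_coveredBySwap_of_valueOp_ne_zero hv'
  rw [y.1.symm_apply_eq.2 (hz0' y hy).symm] at hyb ⊢
  refine ⟨y, b, ?_, hz0' y hy, hb, hyb, rfl⟩
  rw [heq, Finsupp.add_apply]
  exact (add_pos_of_pos_of_nonneg ((hz' y).lt_of_ne' hy) (valueOp_nonneg B m 0 hz' y)).ne'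

theorem exists_coords_prod_one_add_X_mul_schubert (m : ℕ) (u : SInf) :
    ∃ B c, coords ((∏ k ∈ Finset.range m, (1 + X k)) * u.schubert) =
      pieriOp B m (c + 1) (Finsupp.single u 1) := by
  obtain ⟨N, hmN, hu⟩ := exists_fixesFrom_ge u m
  exact ⟨N + m + 1, N + m,
    by rw [prod_one_add_X_mul_schubert hu hmN (Nat.lt_succ_self _), coords_expand]⟩

theorem coords_elemSym_mul_schubert_nonneg (i m : ℕ) (u v : SInf) :
    0 ≤ coords (elemSym i m * u.schubert) v := by
  obtain ⟨B, c, hpieri⟩ := exists_coords_prod_one_add_X_mul_schubert m u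
  rw [coords_elemSym_mul_schubert, hpieri]
  split_ifs
  · exact pieriOp_nonneg B m (c + 1) (Finsupp.single_nonneg.2 zero_le_one) v
  · exact le_rfl

theorem exists_coveredBySwap_of_coords_elemSym_succ_ne_zero {i m : ℕ} {u v : SInf} (hu : u.1 0 = 0)
    (hv : coords (elemSym (i + 1) m * u.schubert) v ≠ 0) (hv0 : v.1 0 ≠ 0) :
    ∃ y b, coords (elemSym i m * u.schubert) y ≠ 0 ∧ y.1 0 = 0 ∧ m ≤ b ∧ y.CoveredBySwap 0 b := by
  obtain ⟨B, c, hpieri⟩ := exists_coords_prod_one_add_X_mul_schubert m u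
  rw [coords_elemSym_mul_schubert, hpieri] at hv
  split_ifs at hv with hlength
  · obtain ⟨y, b, hy, hy0, hb, hyb, rfl⟩ := exists_coveredBySwap_of_pieriOp_ne_zero
      (Finsupp.single_nonneg.2 zero_le_one)
      (fun y hy => by rw [(Finsupp.single_apply_ne_zero.1 hy).1, hu]) hv hv0
    refine ⟨y, b, ?_, hy0, hb, hyb⟩
    rwa [coords_elemSym_mul_schubert, hpieri,
      if_pos (by rw [hyb.length_mulSwap] at hlength; omega)]
  · exact absurd rfl hv

/-- The derivation `∑ₖ ∂/∂xₖ`, which commutes with the exchanges of variables. -/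
noncomputable def nabla : Derivation ℤ (MvPolynomial ℕ ℤ) (MvPolynomial ℕ ℤ) :=
  mkDerivation ℤ fun _ => 1

theorem nabla_X (k : ℕ) : nabla (X k) = 1 := mkDerivation_X ℤ _ k

theorem nabla_swapVar (a : ℕ) (f : MvPolynomial ℕ ℤ) :
    nabla (swapVar a f) = swapVar a (nabla f) := by
  induction f using MvPolynomial.induction_on with
  | C r => simp [swapVar, nabla]
  | add f g hf hg => simp only [map_add, hf, hg]
  | mul_X f k hf =>
    simp only [map_mul, Derivation.leibniz, hf, swapVar_X, nabla_X, smul_eq_mul, map_add, map_one]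

theorem nabla_schubert_sub_swapVar (w : SInf) (a : ℕ) :
    nabla w.schubert - swapVar a (nabla w.schubert) = (X a - X (a + 1)) *
      nabla (if w.1 (a + 1) < w.1 a then (w.mulSwap a (a + 1)).schubert else 0) := by
  rw [← nabla_swapVar, ← map_sub, schubert_sub_swapVar, Derivation.leibniz, map_sub, nabla_X,
    nabla_X, sub_self, smul_zero, add_zero, smul_eq_mul]

theorem nabla_elemSym (i m : ℕ) :
    nabla (elemSym (i + 1) m) = ((m : ℤ) - i) • elemSym i m := by
  induction m generalizing i with
  | zero =>
    rw [elemSym_of_lt (by omega), map_zero]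
    cases i with
    | zero => simp
    | succ i => rw [elemSym_of_lt (by omega), smul_zero]
  | succ m ih =>
    rw [elemSym_succ, map_add, Derivation.leibniz, nabla_X, ih]
    cases i with
    | zero => simp [elemSym_zero_left, add_smul]
    | succ i =>
      rw [ih, elemSym_succ]
      simp only [zsmul_eq_mul, smul_eq_mul]
      push_cast
      ring

theorem constantCoeff_nabla_nonneg {f : MvPolynomial ℕ ℤ} (hf : ∀ d, 0 ≤ coeff d f) :
    0 ≤ constantCoeff (nabla f) := by
  rw [f.as_sum, map_sum, map_sum]
  refine Finset.sum_nonneg fun d _ => ?_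
  rw [nabla, mkDerivation_monomial, smul_eq_C_mul, map_mul, constantCoeff_C, Finsupp.sum, map_sum]
  refine mul_nonneg (hf d) (Finset.sum_nonneg fun k _ => ?_)
  rw [smul_eq_mul, mul_one, constantCoeff_monomial]
  split_ifs
  · exact Int.natCast_nonneg _
  · exact le_rfl

theorem coords_nabla_schubert_one_nonneg (w : SInf) : 0 ≤ coords (nabla w.schubert) 1 := by
  rw [← constantCoeff_expand, expand_coords]
  exact constantCoeff_nabla_nonneg w.coeff_schubert_nonneg

theorem coords_nabla_schubert_of_descent {v : SInf} {a : ℕ} (ha : v.1 (a + 1) < v.1 a)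
    (w : SInf) : coords (nabla w.schubert) v = if w.1 (a + 1) < w.1 a then
      coords (nabla (w.mulSwap a (a + 1)).schubert) (v.mulSwap a (a + 1)) else 0 := by
  have hdivDiff : expand (divDiff a (coords (nabla w.schubert))) =
      nabla (if w.1 (a + 1) < w.1 a then (w.mulSwap a (a + 1)).schubert else 0) :=
    expand_divDiff_eq_of_sub_swapVar_eq
      (by rw [expand_coords, nabla_schubert_sub_swapVar])
  rw [← divDiff_apply_mulSwap ha, ← coords_expand (divDiff a _), hdivDiff]
  split_ifs
  · rfl
  · rw [map_zero, map_zero, Finsupp.zero_apply]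

theorem coords_nabla_schubert_nonneg (v w : SInf) : 0 ≤ coords (nabla w.schubert) v := by
  induction v using induction_on_descents generalizing w with
  | _ v ih =>
    by_cases hv : v = 1
    · rw [hv]
      exact coords_nabla_schubert_one_nonneg w
    · obtain ⟨a, ha⟩ := exists_descent hv
      rw [coords_nabla_schubert_of_descent ha]
      split_ifs
      · exact ih a ha _
      · exact le_rfl

theorem coords_nabla_schubert_eq_zero {v w : SInf} (hw : w.1 0 = 0) (hv : v.1 0 ≠ 0) :
    coords (nabla w.schubert) v = 0 := by
  induction v using induction_on_descents generalizing w with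
  | _ v ih =>
    have hv1 : v ≠ 1 := fun h => hv (by rw [h, one_apply])
    obtain ⟨a, ha⟩ := exists_descent hv1
    rw [coords_nabla_schubert_of_descent ha]
    refine ite_eq_right_iff.2 fun hwa => ih a ha ?_ ?_
    · have ha0 : 0 ≠ a := by
        rintro rfl
        omega
      rwa [mulSwap_apply_of_ne _ ha0 (by omega)]
    · obtain rfl | ha0 := eq_or_ne a 0
      · omega
      · rwa [mulSwap_apply_of_ne _ ha0.symm (by omega)]

theorem nabla_elemSym_mul_schubert (i m : ℕ) (u : SInf) :
    nabla (elemSym (i + 1) m * u.schubert) =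
      elemSym (i + 1) m * nabla u.schubert + ((m : ℤ) - i) • (elemSym i m * u.schubert) := by
  rw [Derivation.leibniz, nabla_elemSym, smul_eq_mul, smul_eq_mul, mul_smul_comm,
    mul_comm u.schubert]

theorem coords_elemSym_mul_nabla_schubert_nonneg (i m : ℕ) (u v : SInf) :
    0 ≤ coords (elemSym i m * nabla u.schubert) v := by
  rw [← LinearMap.mulLeft_apply ℤ, coords_map_apply]
  exact Finset.sum_nonneg fun z _ =>
    mul_nonneg (coords_nabla_schubert_nonneg z u) (coords_elemSym_mul_schubert_nonneg i m z v)

theorem coords_nabla_eq_zero {f : MvPolynomial ℕ ℤ} (hf : ∀ z : SInf, z.1 0 ≠ 0 → coords f z = 0)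
    {v : SInf} (hv : v.1 0 ≠ 0) : coords (nabla f) v = 0 := by
  rw [← Derivation.coeFn_coe, coords_map_apply]
  refine Finset.sum_eq_zero fun z hz => mul_eq_zero_of_right _ ?_
  exact coords_nabla_schubert_eq_zero
    (not_not.1 (mt (hf z) (Finsupp.mem_support_iff.1 hz))) hv

/-- Both summands of `∇ (e_{i+1} 𝔖_u) = e_{i+1} ∇ 𝔖_u + (m - i) e_i 𝔖_u` have nonnegative
coefficients, so no term of the second one is cancelled. -/
theorem coords_elemSym_mul_schubert_eq_zero_of_succ {i m : ℕ} (him : i < m) {u : SInf}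
    (h : ∀ v : SInf, v.1 0 ≠ 0 → coords (elemSym (i + 1) m * u.schubert) v = 0) {v : SInf}
    (hv : v.1 0 ≠ 0) : coords (elemSym i m * u.schubert) v = 0 := by
  have hsum := coords_nabla_eq_zero h hv
  rw [nabla_elemSym_mul_schubert, map_add, map_smul, Finsupp.add_apply, Finsupp.smul_apply,
    smul_eq_mul] at hsum
  have hpos : (0 : ℤ) < m - i := by omega
  have hmul := mul_nonneg hpos.le (coords_elemSym_mul_schubert_nonneg i m u v)
  have hzero := (add_eq_zero_iff_of_nonneg
    (coords_elemSym_mul_nabla_schubert_nonneg (i + 1) m u v) hmul).1 hsum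
  exact (mul_eq_zero.1 hzero.2).resolve_left hpos.ne'

theorem onePow_one_apply_succ (u : SInf) (p : ℕ) : (u.onePow 1).1 (p + 1) = u.1 p + 1 := rfl

theorem onePow_one_injective : Function.Injective (onePow 1) := fun _ _ h =>
  ext_apply fun p => Nat.add_right_cancel (congrArg (fun w : SInf => w.1 (p + 1)) h)

theorem onePow_zero (w : SInf) : w.onePow 0 = w := rfl

theorem onePow_one_one : onePow 1 1 = 1 :=
  ext_apply fun p => by cases p <;> rfl

theorem onePow_succ_apply_zero (k : ℕ) (w : SInf) : (w.onePow (k + 1)).1 0 = 0 := by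
  simp only [onePow, Equiv.coe_fn_mk, if_pos k.succ_pos]

theorem onePow_one_onePow (k : ℕ) (w : SInf) : (w.onePow k).onePow 1 = w.onePow (k + 1) := by
  refine ext_apply fun p => ?_
  cases p with
  | zero => rw [onePow_succ_apply_zero, onePow_succ_apply_zero]
  | succ p =>
    simp only [onePow, Equiv.coe_fn_mk]
    by_cases hp : p < k
    · rw [if_neg (by omega), Nat.add_sub_cancel, if_pos hp, if_pos (by omega)]
    · rw [if_neg (by omega), Nat.add_sub_cancel, if_neg hp, if_neg (by omega),
        Nat.add_sub_add_right, add_assoc]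

theorem exists_eq_onePow_one {v : SInf} (hv : v.1 0 = 0) : ∃ u : SInf, v = u.onePow 1 := by
  have happly (p : ℕ) : v.1 (p + 1) ≠ 0 := by
    rw [← hv]
    exact v.apply_ne_apply p.succ_ne_zero
  have hsymm (p : ℕ) : v.1.symm (p + 1) ≠ 0 := by
    rw [Ne, Equiv.symm_apply_eq, hv]
    exact p.succ_ne_zero
  let u : Equiv.Perm ℕ :=
    { toFun := fun p => v.1 (p + 1) - 1
      invFun := fun p => v.1.symm (p + 1) - 1
      left_inv := fun p => by
        simp only [Nat.sub_one_add_one (happly p)]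
        rw [Equiv.symm_apply_apply, Nat.add_sub_cancel]
      right_inv := fun p => by
        simp only [Nat.sub_one_add_one (hsymm p)]
        rw [Equiv.apply_symm_apply, Nat.add_sub_cancel] }
  obtain ⟨N, hN⟩ := v.2
  refine ⟨⟨u, N, fun p hp => ?_⟩, ext_apply fun p => ?_⟩
  · change v.1 (p + 1) - 1 = p
    rw [hN (p + 1) (by omega), Nat.add_sub_cancel]
  · cases p with
    | zero => exact hv
    | succ p => exact (Nat.sub_one_add_one (happly p)).symm

theorem onePow_one_mulSwap (u : SInf) (a b : ℕ) :
    (u.onePow 1).mulSwap (a + 1) (b + 1) = (u.mulSwap a b).onePow 1 := by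
  refine ext_apply fun p => ?_
  cases p with
  | zero => exact mulSwap_apply_of_ne _ a.succ_ne_zero.symm b.succ_ne_zero.symm
  | succ p =>
    simp only [onePow_one_apply_succ, mulSwap_apply_ite, Nat.add_right_cancel_iff]
    split_ifs <;> rfl

/-- The substitution `x₀ = 0`, `x_{k+1} = x_k`, which undoes the passage from `u` to `1 × u`. -/
noncomputable def dropVar : MvPolynomial ℕ ℤ →ₐ[ℤ] MvPolynomial ℕ ℤ :=
  aeval fun k => Nat.casesOn k 0 X

theorem dropVar_X_zero : dropVar (X 0) = 0 := aeval_X _ 0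

theorem dropVar_X_succ (k : ℕ) : dropVar (X (k + 1)) = X k := aeval_X _ (k + 1)

theorem dropVar_swapVar (a : ℕ) (f : MvPolynomial ℕ ℤ) :
    dropVar (swapVar (a + 1) f) = swapVar a (dropVar f) := by
  suffices dropVar.comp (swapVar (a + 1)) = (swapVar a).comp dropVar from DFunLike.congr_fun this f
  refine algHom_ext fun k => ?_
  rw [AlgHom.comp_apply, AlgHom.comp_apply, swapVar_X]
  cases k with
  | zero => rw [Equiv.swap_apply_of_ne_of_ne (by omega) (by omega), dropVar_X_zero, map_zero]
  | succ k =>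
    rw [dropVar_X_succ, swapVar_X, Equiv.swap_apply_def, Equiv.swap_apply_def]
    simp only [Nat.add_right_cancel_iff]
    split_ifs <;> exact dropVar_X_succ _

theorem constantCoeff_dropVar (f : MvPolynomial ℕ ℤ) :
    constantCoeff (dropVar f) = constantCoeff f := by
  suffices constantCoeff.comp (dropVar : MvPolynomial ℕ ℤ →+* MvPolynomial ℕ ℤ) =
    constantCoeff from DFunLike.congr_fun this f
  refine ringHom_ext (fun r => by simp) fun k => ?_
  cases k with
  | zero => simp [dropVar_X_zero]
  | succ k => simp [dropVar_X_succ]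

theorem dropVar_schubert_sub_swapVar (v : SInf) (a : ℕ) :
    dropVar v.schubert - swapVar a (dropVar v.schubert) = (X a - X (a + 1)) *
      if v.1 (a + 2) < v.1 (a + 1) then dropVar (v.mulSwap (a + 1) (a + 2)).schubert else 0 := by
  rw [← dropVar_swapVar, ← map_sub, schubert_sub_swapVar, map_mul, map_sub, dropVar_X_succ,
    dropVar_X_succ, apply_ite dropVar, map_zero]

theorem dropVar_schubert_of_apply_zero_ne {v : SInf} (hv : v.1 0 ≠ 0) :
    dropVar v.schubert = 0 := by
  induction v using induction_on_descents with
  | _ v ih =>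
    refine eq_of_forall_sub_swapVar_eq (fun a => ?_) ?_
    · rw [dropVar_schubert_sub_swapVar, map_zero, sub_zero]
      refine mul_eq_zero_of_right _ (ite_eq_right_iff.2 fun ha => ih (a + 1) ha ?_)
      rwa [mulSwap_apply_of_ne _ (by omega) (by omega)]
    · rw [constantCoeff_dropVar, constantCoeff_schubert fun h => hv (by rw [h, one_apply]),
        map_zero]

theorem constantCoeff_schubert_onePow_one (u : SInf) :
    constantCoeff (u.onePow 1).schubert = constantCoeff u.schubert := by
  by_cases hu : u = 1
  · rw [hu, onePow_one_one]
  · have hu' : u.onePow 1 ≠ 1 := fun h => hu (onePow_one_injective (h.trans onePow_one_one.symm))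
    rw [constantCoeff_schubert hu, constantCoeff_schubert hu']

theorem dropVar_schubert_onePow_one (u : SInf) : dropVar (u.onePow 1).schubert = u.schubert := by
  induction u using induction_on_descents with
  | _ u ih =>
    refine eq_of_forall_sub_swapVar_eq (fun a => ?_) ?_
    · rw [dropVar_schubert_sub_swapVar, schubert_sub_swapVar]
      simp only [onePow_one_apply_succ, Nat.add_lt_add_iff_right, onePow_one_mulSwap]
      congr 1
      exact ite_congr rfl (fun ha => ih a ha) fun _ => rfl
    · rw [constantCoeff_dropVar, constantCoeff_schubert_onePow_one]

theorem dropVar_elemSym_succ (i m : ℕ) : dropVar (elemSym i (m + 1)) = elemSym i m := by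
  cases i with
  | zero => rw [elemSym_zero_left, elemSym_zero_left, map_one]
  | succ i =>
    induction m generalizing i with
    | zero =>
      rw [elemSym_succ, map_add, map_mul, dropVar_X_zero, zero_mul, add_zero,
        elemSym_of_lt i.succ_pos, map_zero]
    | succ m ih =>
      have hi : dropVar (elemSym i (m + 1)) = elemSym i m := by
        cases i with
        | zero => rw [elemSym_zero_left, elemSym_zero_left, map_one]
        | succ i => exact ih i
      rw [elemSym_succ, map_add, map_mul, ih, hi, dropVar_X_succ, elemSym_succ]

theorem coords_dropVar (f : MvPolynomial ℕ ℤ) (v : SInf) :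
    coords (dropVar f) v = coords f (v.onePow 1) := by
  obtain ⟨c, rfl⟩ := expand_surjective f
  rw [coords_expand]
  induction c using Finsupp.induction_linear with
  | zero => simp only [map_zero, Finsupp.coe_zero, Pi.zero_apply]
  | add c d hc hd => simp only [map_add, Finsupp.add_apply, hc, hd]
  | single z r =>
    rw [expand_single, map_smul, map_smul, Finsupp.smul_apply, smul_eq_mul]
    by_cases hz : z.1 0 = 0
    · obtain ⟨u, rfl⟩ := exists_eq_onePow_one hz
      rw [dropVar_schubert_onePow_one, coords_schubert]
      obtain rfl | huv := eq_or_ne u v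
      · rw [Finsupp.single_eq_same, Finsupp.single_eq_same, mul_one]
      · rw [Finsupp.single_eq_of_ne huv.symm,
          Finsupp.single_eq_of_ne (onePow_one_injective.ne huv.symm), mul_zero]
    · have hzv : v.onePow 1 ≠ z := fun h => hz (by rw [← h, onePow_succ_apply_zero])
      rw [dropVar_schubert_of_apply_zero_ne hz, Finsupp.single_eq_of_ne hzv, map_zero,
        Finsupp.zero_apply, mul_zero]

theorem isSchubertExpansion_iff_eq_coords {f : MvPolynomial ℕ ℤ} {c : SInf →₀ ℤ} :
    IsSchubertExpansion f c ↔ c = coords f := by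
  rw [isSchubertExpansion_iff]
  constructor
  · rintro rfl
    exact (coords_expand c).symm
  · rintro rfl
    exact (expand_coords f).symm

/-- The coefficients of the expansion of `e_i^{j+k} 𝔖_{1ᵏ × w}`, denoted `β⁽ᵏ⁾` in the statement
of the lemma. -/
noncomputable def stableCoords (i j : ℕ) (w : SInf) (k : ℕ) : SInf →₀ ℤ :=
  coords (elemSym i (j + k) * (w.onePow k).schubert)

theorem stableCoords_succ_onePow (i j : ℕ) (w : SInf) (k : ℕ) (v : SInf) :
    stableCoords i j w (k + 1) (v.onePow 1) = stableCoords i j w k v := by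
  rw [stableCoords, ← coords_dropVar, map_mul, ← add_assoc, dropVar_elemSym_succ,
    ← onePow_one_onePow, dropVar_schubert_onePow_one, stableCoords]

/-- Some permutation moving the first letter appears in the expansion of `e_i^{j+k} 𝔖_{1ᵏ × w}`.
For `k ≥ 1` this means that the set `W_k` of new permutations is nonempty. -/
def HasNewTerm (i j : ℕ) (w : SInf) (k : ℕ) : Prop :=
  ∃ v : SInf, stableCoords i j w k v ≠ 0 ∧ v.1 0 ≠ 0

theorem mem_newPerms_stableCoords {i j k : ℕ} (hk : 1 ≤ k) {w v : SInf} :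
    v ∈ newPerms (stableCoords i j w) k ↔ stableCoords i j w k v ≠ 0 ∧ v.1 0 ≠ 0 := by
  classical
  obtain ⟨k, rfl⟩ := Nat.exists_eq_add_of_le' hk
  rw [newPerms, Finset.mem_sdiff, Finsupp.mem_support_iff, Finset.mem_image]
  refine and_congr_right fun hv => not_congr ⟨?_, fun hv0 => ?_⟩
  · rintro ⟨u, -, rfl⟩
    exact onePow_succ_apply_zero 0 u
  · obtain ⟨u, rfl⟩ := exists_eq_onePow_one hv0
    rw [stableCoords_succ_onePow] at hv
    exact ⟨u, Finsupp.mem_support_iff.2 hv, rfl⟩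

theorem newPerms_stableCoords_nonempty_iff {i j k : ℕ} (hk : 1 ≤ k) {w : SInf} :
    (newPerms (stableCoords i j w) k).Nonempty ↔ HasNewTerm i j w k :=
  exists_congr fun _ => mem_newPerms_stableCoords hk

theorem not_hasNewTerm_zero_left_succ (j : ℕ) (w : SInf) (k : ℕ) :
    ¬ HasNewTerm 0 j w (k + 1) := by
  rintro ⟨v, hv, hv0⟩
  rw [stableCoords, elemSym_zero_left, one_mul, coords_schubert,
    Finsupp.single_apply_ne_zero] at hv
  rw [hv.1, onePow_succ_apply_zero] at hv0
  exact hv0 rfl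

theorem CoveredBySwap.apply_zero_ne_zero_of_onePow_one {y : SInf} {b : ℕ} (hb : 1 < b)
    (h : (y.onePow 1).CoveredBySwap 0 b) : y.1 0 ≠ 0 := by
  intro hy
  have hbetween := h.2.2 1 one_pos hb
  have hascent := h.2.1
  have hone : (y.onePow 1).1 1 = 1 := by rw [onePow_one_apply_succ y 0, hy]
  rw [onePow_succ_apply_zero] at hbetween hascent
  omega

theorem HasNewTerm.of_succ_succ {i j : ℕ} {w : SInf} {k : ℕ} (hk : 1 ≤ k)
    (h : HasNewTerm (i + 1) j w (k + 1)) : HasNewTerm i j w k := by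
  obtain ⟨v, hv, hv0⟩ := h
  obtain ⟨y, b, hy, hy0, hb, hyb⟩ := exists_coveredBySwap_of_coords_elemSym_succ_ne_zero
    (onePow_succ_apply_zero k w) hv hv0
  obtain ⟨y, rfl⟩ := exists_eq_onePow_one hy0
  exact ⟨y, by rwa [← stableCoords_succ_onePow],
    hyb.apply_zero_ne_zero_of_onePow_one (by omega)⟩

theorem HasNewTerm.le {i j : ℕ} {w : SInf} {k : ℕ} (hk : 1 ≤ k) (h : HasNewTerm i j w k) :
    k ≤ i := by
  induction k, hk using Nat.le_induction generalizing i with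
  | base =>
    cases i with
    | zero => exact absurd h (not_hasNewTerm_zero_left_succ j w 0)
    | succ i => exact i.succ_pos
  | succ k hk ih =>
    cases i with
    | zero => exact absurd h (not_hasNewTerm_zero_left_succ j w k)
    | succ i => exact Nat.succ_le_succ (ih (h.of_succ_succ hk))

theorem HasNewTerm.succ_left {i j : ℕ} {w : SInf} {k : ℕ} (hi : i < j + k)
    (h : HasNewTerm i j w k) : HasNewTerm (i + 1) j w k := by
  obtain ⟨v, hv, hv0⟩ := h
  by_contra! hnone
  refine hv (coords_elemSym_mul_schubert_eq_zero_of_succ hi (fun z hz => ?_) hv0)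
  by_contra hne
  exact hnone ⟨z, hne, hz⟩

theorem HasNewTerm.of_succ {i j : ℕ} {w : SInf} {k : ℕ} (hk : 1 ≤ k) (hi : i ≤ j + k)
    (h : HasNewTerm i j w (k + 1)) : HasNewTerm i j w k := by
  cases i with
  | zero => exact absurd h (not_hasNewTerm_zero_left_succ j w k)
  | succ i => exact (h.of_succ_succ hk).succ_left hi

theorem HasNewTerm.of_le {i j : ℕ} {w : SInf} {s k : ℕ} (hs : 1 ≤ s) (hi : i ≤ j + s)
    (hsk : s ≤ k) (h : HasNewTerm i j w k) : HasNewTerm i j w s :=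
  Nat.decreasingInduction' (fun l _ hl hl' => hl'.of_succ (hs.trans hl) (by omega)) hsk h

theorem exists_last_hasNewTerm (i j : ℕ) (w : SInf) :
    ∃ r, (1 ≤ r → HasNewTerm i j w r) ∧ ∀ s, r < s → ¬ HasNewTerm i j w s := by
  classical
  exact ⟨Nat.findGreatest (HasNewTerm i j w) i,
    fun hr => Nat.findGreatest_of_ne_zero rfl (Nat.one_le_iff_ne_zero.1 hr),
    fun s hs hnew => hs.not_ge (Nat.le_findGreatest (hnew.le (by omega)) hnew)⟩

theorem sum_stableCoords_eq_sum_newPerms (i j : ℕ) (w : SInf) (k : ℕ)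
    (g : SInf → MvPolynomial ℕ ℤ) :
    ∑ v ∈ (stableCoords i j w k).support, C (stableCoords i j w k v) * g v =
      ∑ s ∈ Finset.range (k + 1), ∑ v ∈ newPerms (stableCoords i j w) s,
        C (stableCoords i j w s v) * g (v.onePow (k - s)) := by
  classical
  induction k generalizing g with
  | zero =>
    rw [Finset.sum_range_one]
    simp only [newPerms, Nat.sub_zero, onePow_zero]
  | succ k ih =>
    have hsub : (stableCoords i j w k).support.image (onePow 1) ⊆
        (stableCoords i j w (k + 1)).support := by
      intro v hv
      obtain ⟨u, hu, rfl⟩ := Finset.mem_image.1 hv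
      rw [Finsupp.mem_support_iff] at hu ⊢
      rwa [stableCoords_succ_onePow]
    have hold : ∑ v ∈ (stableCoords i j w k).support.image (onePow 1),
        C (stableCoords i j w (k + 1) v) * g v =
          ∑ s ∈ Finset.range (k + 1), ∑ v ∈ newPerms (stableCoords i j w) s,
            C (stableCoords i j w s v) * g (v.onePow (k + 1 - s)) := by
      rw [Finset.sum_image onePow_one_injective.injOn]
      simp only [stableCoords_succ_onePow]
      rw [ih fun v => g (v.onePow 1)]
      refine Finset.sum_congr rfl fun s hs => Finset.sum_congr rfl fun v _ => ?_
      rw [onePow_one_onePow, Nat.sub_add_comm (Finset.mem_range_succ_iff.1 hs)]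
    rw [← Finset.sum_sdiff hsub, Finset.sum_range_succ, add_comm, hold]
    simp only [newPerms, Nat.sub_self, onePow_zero]

theorem elemSym_mul_schubert_onePow_eq_sum_newPerms {i j r k : ℕ} {w : SInf} (hrk : r ≤ k)
    (hlast : ∀ s, r < s → newPerms (stableCoords i j w) s = ∅) :
    elemSym i (j + k) * (w.onePow k).schubert =
      ∑ s ∈ Finset.range (r + 1), ∑ v ∈ newPerms (stableCoords i j w) s,
        C (stableCoords i j w s v) * (v.onePow (k - s)).schubert := by
  have hexpansion : IsSchubertExpansion (elemSym i (j + k) * (w.onePow k).schubert)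
      (stableCoords i j w k) := isSchubertExpansion_iff_eq_coords.2 rfl
  refine Eq.trans hexpansion ?_
  rw [sum_stableCoords_eq_sum_newPerms i j w k schubert, eq_comm]
  refine Finset.sum_subset (Finset.range_subset_range.2 (by omega)) fun s _ hs => ?_
  rw [hlast s (by rw [Finset.mem_range] at hs; omega), Finset.sum_empty]

end SInf

open SInf in
theorem mainTheorem6_general (i j : ℕ) (w : SInf) :
    ∃ c : ℕ → SInf →₀ ℤ,
      (∀ k, IsSchubertExpansion (elemSym i (j + k) * (w.onePow k).schubert) (c k) ∧
        ∀ c', IsSchubertExpansion (elemSym i (j + k) * (w.onePow k).schubert) c' → c' = c k) ∧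
      (∀ k v, c (k + 1) (v.onePow 1) = c k v) ∧
      (∀ k, 1 ≤ k → ∀ v ∈ newPerms c k, v.1 0 ≠ 0) ∧
      ∃ r : ℕ,
        (∀ k, r ≤ k →
          elemSym i (j + k) * (w.onePow k).schubert =
            ∑ s ∈ Finset.range (r + 1), ∑ v ∈ newPerms c s,
              MvPolynomial.C (c s v) * (v.onePow (k - s)).schubert) ∧
        (∀ s, 1 ≤ s → i ≤ j + s → s ≤ r → (newPerms c s).Nonempty) ∧
        (∀ s, r < s → newPerms c s = ∅) := by
  obtain ⟨r, hr, hlast⟩ := exists_last_hasNewTerm i j w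
  have hempty (s : ℕ) (hs : r < s) : newPerms (stableCoords i j w) s = ∅ := by
    rw [← Finset.not_nonempty_iff_eq_empty, newPerms_stableCoords_nonempty_iff (by omega)]
    exact hlast s hs
  refine ⟨stableCoords i j w, fun k => ?_, stableCoords_succ_onePow i j w, fun k hk v hv => ?_,
    r, fun k hk => ?_, fun s hs hi hsr => ?_, hempty⟩
  · exact ⟨isSchubertExpansion_iff_eq_coords.2 rfl,
      fun c' => isSchubertExpansion_iff_eq_coords.1⟩
  · exact ((mem_newPerms_stableCoords hk).1 hv).2
  · exact elemSym_mul_schubert_onePow_eq_sum_newPerms hk hempty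
  · exact (newPerms_stableCoords_nonempty_iff hs).2 ((hr (hs.trans hsr)).of_le hs hi hsr)

theorem mainTheorem6 (i j : ℕ) (hij : i ≤ j) (w : SInf) :
    ∃ c : ℕ → SInf →₀ ℤ,
      -- `c k` is the unique expansion of `e_i^{j+k} 𝔖_{1ᵏ × w}` into Schubert polynomials
      (∀ k, IsSchubertExpansion (elemSym i (j + k) * (w.onePow k).schubert) (c k) ∧
        ∀ c', IsSchubertExpansion (elemSym i (j + k) * (w.onePow k).schubert) c' → c' = c k) ∧
      -- each step keeps the old terms with their coefficients, and no new term starts with `1`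
      (∀ k v, c (k + 1) (v.onePow 1) = c k v) ∧
      (∀ k, 1 ≤ k → ∀ v ∈ newPerms c k, v.1 0 ≠ 0) ∧
      ∃ r : ℕ,
        (∀ k, r ≤ k →
          elemSym i (j + k) * (w.onePow k).schubert =
            ∑ s ∈ Finset.range (r + 1), ∑ v ∈ newPerms c s,
              MvPolynomial.C (c s v) * (v.onePow (k - s)).schubert) ∧
        (∀ s, 1 ≤ s → s ≤ r → (newPerms c s).Nonempty) ∧
        (∀ s, r < s → newPerms c s = ∅) := by
  obtain ⟨c, hexpansion, hstable, hfirst, r, hsum, hnew, hlast⟩ := mainTheorem6_general i j w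
  exact ⟨c, hexpansion, hstable, hfirst, r, hsum, fun s hs => hnew s hs (by omega), hlast⟩
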